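/- Let $p$ be a prime and $\bar{\mathbb F}_p$ an algebraic closure of $\mathbb F_p$. Let $\mathcal F_{\mathrm{GL}_2}$ be the affine Grassmannian of $\mathrm{GL}_2$ over $\bar{\mathbb F}_p$; its closed points are the $\bar{\mathbb F}_p[[u]]$-lattices $\mathfrak M\subset\bar{\mathbb F}_p((u))^2$. Let $\bar{\mathcal B}$ be the Bruhat–Tits building of $\mathrm{PGL}_2(\bar{\mathbb F}_p((u)))$, i.e. the geometric realization of the tree whose vertices are the homothety classes $[\mathfrak M]$ of lattices, two distinct classes being adjacent if they have representatives with $u\mathfrak M\subset\mathfrak M'\subset\mathfrak M$. Let $d$ be the path metric on $\bar{\mathcal B}$ in which every edge has length $1$. Let $m\in\mathbb Z$, let $x_1,x_2\in\bar{\mathcal B}$ be arbitrary points (not necessarily vertices) and let $r_1,r_2\in\mathbb Q$. Let $X$ be the set of lattices $\mathfrak M\subset\bar{\mathbb F}_p((u))^2$ with $$\det\mathfrak M=u^m\,\bar{\mathbb F}_p[[u]],\qquad d([\mathfrak M],x_1)\le r_1,\qquad d([\mathfrak M],x_2)\le r_2,$$ where $\det\mathfrak M\subset\bar{\mathbb F}_p((u))$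 denotes the image of $\bigwedge^2\mathfrak M$. Then $X$ is the set of closed points of a (reduced, projective) closed subvariety of $\mathcal F_{\mathrm{GL}_2}$, that is, it is Zariski closed and there is $n\ge 0$ with $u^n\bar{\mathbb F}_p[[u]]^2\subset\mathfrak M\subset u^{-n}\bar{\mathbb F}_p[[u]]^2$ for all $\mathfrak M\in X$. If $X$ is non-empty, then it is a Schubert variety: there are a lattice $\mathfrak N$ and a lattice $\widetilde{\mathfrak M}$ such that $X$ is the Zariski closure of the orbit $\mathrm{GL}(\mathfrak N)\cdot\widetilde{\mathfrak M}$, where $\mathrm{GL}(\mathfrak N)\subset\mathrm{GL}_2(\bar{\mathbb F}_p((u)))$ is the stabilizer of $\mathfrak N$. In particular, if $X$ is non-empty, it is connected. -/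

import Mathlib

open scoped LaurentSeries PowerSeries Pointwise MatrixGroups

noncomputable section

namespace AffGr

/-! ### Lattices in `k((u))²` -/

/-- The `k`-points of the affine Grassmannian of `GL₂`: the `k[[u]]`-lattices in `k((u))²`. -/
@[ext]
structure GrLattice (k : Type*) [Field k] where
  toSubmodule : Submodule k⟦X⟧ (Fin 2 → k⸨X⸩)
  isLattice : toSubmodule.IsLattice k⸨X⸩

section

variable {k : Type*} [Field k]

/-- The uniformizer `u`, as a unit of `k((u))`. -/
def u (k : Type*) [Field k] : k⸨X⸩ˣ :=
  Units.mk0 (HahnSeries.single (1 : ℤ) (1 : k)) (by simp)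

/-- The `k[[u]]`-linear automorphism of `k((u))²` given by an invertible matrix. -/
def glMap (g : GL (Fin 2) k⸨X⸩) : (Fin 2 → k⸨X⸩) →ₗ[k⟦X⟧] (Fin 2 → k⸨X⸩) :=
  (Matrix.mulVecLin (g : Matrix (Fin 2) (Fin 2) k⸨X⸩)).restrictScalars k⟦X⟧

lemma glMap_apply (g : GL (Fin 2) k⸨X⸩) (v : Fin 2 → k⸨X⸩) :
    glMap g v = (g : Matrix (Fin 2) (Fin 2) k⸨X⸩).mulVec v := rfl

lemma isLattice_map (g : GL (Fin 2) k⸨X⸩) (L : GrLattice k) :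
    (L.toSubmodule.map (glMap g)).IsLattice k⸨X⸩ where
  fg := L.isLattice.fg.map _
  span_eq_top := by
    rw [eq_top_iff]
    intro v _
    have h : (g⁻¹ : GL (Fin 2) k⸨X⸩).1.mulVec v ∈
        Submodule.span k⸨X⸩ (L.toSubmodule : Set (Fin 2 → k⸨X⸩)) := by
      rw [L.isLattice.span_eq_top]; trivial
    have h2 := Submodule.mem_map_of_mem (f := Matrix.mulVecLin g.1) h
    rw [Submodule.map_span, Matrix.mulVecLin_apply, Matrix.mulVec_mulVec, ← Units.val_mul,
      mul_inv_cancel, Units.val_one, Matrix.one_mulVec] at h2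
    exact h2

/-- `GL₂(k((u)))` acts on lattices by taking images. -/
instance : MulAction (GL (Fin 2) k⸨X⸩) (GrLattice k) where
  smul g L := ⟨L.toSubmodule.map (glMap g), isLattice_map g L⟩
  one_smul L := by
    apply GrLattice.ext
    change L.toSubmodule.map (glMap 1) = L.toSubmodule
    have : glMap (1 : GL (Fin 2) k⸨X⸩) = LinearMap.id := by
      apply LinearMap.ext; intro v; simp [glMap_apply]
    rw [this, Submodule.map_id]
  mul_smul g h L := by
    apply GrLattice.ext
    change L.toSubmodule.map (glMap (g * h)) = (L.toSubmodule.map (glMap h)).map (glMap g)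
    rw [← Submodule.map_comp]
    congr 1
    apply LinearMap.ext; intro v
    rw [LinearMap.comp_apply, glMap_apply, glMap_apply, glMap_apply, Matrix.mulVec_mulVec]
    rfl

/-- `k((u))ˣ` acts on lattices by scaling. -/
instance : MulAction k⸨X⸩ˣ (GrLattice k) where
  smul c L := ⟨c • L.toSubmodule, haveI := L.isLattice; inferInstance⟩
  one_smul L := GrLattice.ext (one_smul _ L.toSubmodule)
  mul_smul c d L := GrLattice.ext (mul_smul c d L.toSubmodule)

/-- The stabilizer `GL(𝔑)` of a lattice `𝔑` in `GL₂(k((u)))`. -/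
abbrev latticeGL (N : GrLattice k) : Subgroup (GL (Fin 2) k⸨X⸩) :=
  MulAction.stabilizer (GL (Fin 2) k⸨X⸩) N

/-- The determinant of a lattice `M`: the image of `⋀² M` in `⋀² k((u))² = k((u))`. -/
def GrLattice.det (M : GrLattice k) : Submodule k⟦X⟧ k⸨X⸩ :=
  Submodule.span k⟦X⟧
    {d | ∃ v ∈ M.toSubmodule, ∃ w ∈ M.toSubmodule, d = Matrix.det (Matrix.of ![v, w])}

/-- The standard lattice `k[[u]]²`. -/
def standardLattice (k : Type*) [Field k] : GrLattice k where
  toSubmodule := Submodule.span k⟦X⟧ (Set.range fun i : Fin 2 => Pi.single i (1 : k⸨X⸩))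
  isLattice :=
    { fg := Submodule.fg_span (Set.finite_range _)
      span_eq_top := by
        rw [Submodule.span_span_of_tower, eq_top_iff, ← (Pi.basisFun k⸨X⸩ (Fin 2)).span_eq]
        apply Submodule.span_mono
        rintro _ ⟨i, rfl⟩
        exact ⟨i, by simp⟩ }

/-! ### The Zariski topology on the affine Grassmannian

The affine Grassmannian is the union over `n` of the closed subvarieties of lattices `L` with
`uⁿ k[[u]]² ⊆ L ⊆ u⁻ⁿ k[[u]]²`, each of which is a closed subvariety of the disjoint union over `d`
of the Grassmannians of `d`-dimensional subspaces of `u⁻ⁿ k[[u]]² / uⁿ k[[u]]²`. The topology of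
the Grassmannian of `d`-dimensional subspaces of a vector space `W` is the quotient topology from
the Zariski open subset of `W^d` of linearly independent families. -/

/-- The Zariski topology on affine space `k^σ`. -/
abbrev zariskiTopology (σ k : Type*) [Field k] : TopologicalSpace (σ → k) :=
  TopologicalSpace.induced
    (MvPolynomial.pointToPoint : (σ → k) → PrimeSpectrum (MvPolynomial σ k)) inferInstance

/-- Indices for the coefficients of `d` vectors in `u⁻ⁿ k[[u]]² / uⁿ k[[u]]²`: the vector, its
component, and the exponent of `u`. -/
abbrev FrameIndex (n d : ℕ) : Type := Fin d × Fin 2 × Finset.Ico (-(n : ℤ)) n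

/-- The `i`-th Laurent polynomial vector with the given coefficients. -/
def frameVector {n d : ℕ} (c : FrameIndex n d → k) (i : Fin d) : Fin 2 → k⸨X⸩ :=
  fun a => ∑ j : Finset.Ico (-(n : ℤ)) n, HahnSeries.single (j : ℤ) (c (i, a, j))

/-- A lattice `L` with `uⁿ k[[u]]² ⊆ L ⊆ u⁻ⁿ k[[u]]²`, with a `k`-basis of `L / uⁿ k[[u]]²`
having `d` elements. -/
structure Frame (k : Type*) [Field k] (n d : ℕ) where
  coeffs : FrameIndex n d → k
  lattice : GrLattice k
  linearIndependent : LinearIndependent k (frameVector coeffs)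
  mem_iff : ∀ v : Fin 2 → k⸨X⸩, v ∈ lattice.toSubmodule ↔
    ∃ t : Fin d → k, v - ∑ i, t i • frameVector coeffs i ∈
      (u k ^ n • standardLattice k).toSubmodule

/-- The subspace topology from the Zariski topology on the coefficients. -/
instance (n d : ℕ) : TopologicalSpace (Frame k n d) :=
  TopologicalSpace.induced Frame.coeffs (zariskiTopology (FrameIndex n d) k)

/-- The Zariski topology on the `k`-points of the affine Grassmannian: a set is closed iff its
preimage in each `Frame k n d` is closed. -/
instance : TopologicalSpace (GrLattice k) :=
  ⨆ (n : ℕ) (d : ℕ),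
    TopologicalSpace.coinduced (Frame.lattice : Frame k n d → GrLattice k) inferInstance

/-- A (reduced, projective) closed subvariety of the affine Grassmannian, given by its `k`-points:
a Zariski closed subset contained in one of the closed subvarieties of lattices `L` with
`uⁿ k[[u]]² ⊆ L ⊆ u⁻ⁿ k[[u]]²`. -/
def IsClosedSubvariety (X : Set (GrLattice k)) : Prop :=
  IsClosed X ∧ ∃ n : ℕ, ∀ L ∈ X,
    (u k ^ n • standardLattice k).toSubmodule ≤ L.toSubmodule ∧
    L.toSubmodule ≤ ((u k)⁻¹ ^ n • standardLattice k).toSubmodule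

end

/-! ### The tree of `PGL₂(k((u)))` -/

/-- The vertices of the tree: homothety classes of lattices. -/
abbrev Vertex (k : Type*) [Field k] : Type _ :=
  MulAction.orbitRel.Quotient k⸨X⸩ˣ (GrLattice k)

/-- The homothety class of a lattice. -/
def GrLattice.vertex {k : Type*} [Field k] (M : GrLattice k) : Vertex k :=
  Quotient.mk _ M

/-- The Bruhat-Tits tree: two different homothety classes are adjacent iff they have
representatives `M`, `M'` with `u M ⊆ M' ⊆ M`. -/
def tree (k : Type*) [Field k] : SimpleGraph (Vertex k) :=
  SimpleGraph.fromRel fun v w => ∃ M M' : GrLattice k, M.vertex = v ∧ M'.vertex = w ∧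
    (u k • M).toSubmodule ≤ M'.toSubmodule ∧ M'.toSubmodule ≤ M.toSubmodule

/-- The geometric realization of a graph: a point is given by its barycentric coordinates, which
are supported in a vertex or an edge. -/
structure Realization {V : Type*} (G : SimpleGraph V) where
  coord : V →₀ ℝ
  nonneg : ∀ v, 0 ≤ coord v
  sum_eq_one : (coord.sum fun _ t => t) = 1
  support_subset : ∃ a b, (a = b ∨ G.Adj a b) ∧ (coord.support : Set V) ⊆ {a, b}

/-- A vertex of a graph as a point of the geometric realization. -/
def Realization.ofVertex {V : Type*} (G : SimpleGraph V) (v : V) : Realization G where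
  coord := Finsupp.single v 1
  nonneg w := by classical rw [Finsupp.single_apply]; split_ifs <;> norm_num
  sum_eq_one := by simp
  support_subset := ⟨v, v, Or.inl rfl, fun w hw => by
    have := Finsupp.support_single_subset hw
    simpa using this⟩

/-- The path metric on the geometric realization of a tree, all edges having length `1`. On the
closed edge from `a` to `b`, the points with coordinates `(1 - s, s)` and `(1 - t, t)` have
distance `|s - t|`. For two points `x`, `y` that do not lie in a common edge, the geodesic leaves
the edge of `x` through a vertex `a`, where `x` and `a` have distance `1 - x a`, and enters the
edge of `y` through a vertex `b`. -/
def Realization.dist {V : Type*} {G : SimpleGraph V} (x y : Realization G) : ℝ :=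
  open scoped Classical in
  if ∃ a b, (a = b ∨ G.Adj a b) ∧
    (x.coord.support : Set V) ⊆ {a, b} ∧ (y.coord.support : Set V) ⊆ {a, b}
  then (1 / 2) * (x.coord - y.coord).sum fun _ t => |t|
  else ⨅ e : x.coord.support × y.coord.support,
    ((1 - x.coord e.1) + (G.dist (e.1 : V) (e.2 : V) : ℝ) + (1 - y.coord e.2))

/-- The building of `PGL₂(k((u)))`: the geometric realization of the tree. -/
abbrev Building (k : Type*) [Field k] : Type _ := Realization (tree k)

/-- The homothety class of a lattice as a point of the building. -/
def GrLattice.point {k : Type*} [Field k] (M : GrLattice k) : Building k :=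
  Realization.ofVertex (tree k) M.vertex

end AffGr

end

noncomputable section

namespace AffGr
variable {k : Type*} [Field k]

/-! ### Membership in lattices -/

/-! Once the determinant is fixed, a ball in the building is an inclusion condition. In bases
adapted to `M` and `N`, with exponents `e 1 ≤ e 0`, the distance of the classes is `e 0 - e 1`
(`dist_vertex`), while `e 0 + e 1` is fixed by the determinants. So bounding the distance means
bounding `e 1` from below, that is, requiring `M ⊆ u ^ j N` for a suitable `j`
(`dist_vertex_le_iff`). For a point inside an edge the ball is a union of two such conditions, but
the multiples of the lattices at the two ends form a chain, so the weaker condition suffices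
(`exists_dist_point_le_iff`). Two balls give `M ⊆ L₁ ∩ L₂`, and `X` becomes `schubertSet N m` with
`N = L₁ ∩ L₂`.

In this set `GL(N)`-orbits are told apart by the smaller exponent. The orbit with exponent `0`
consists of the `M` not contained in `u N`. Every other member lies in its closure: a unipotent
family through `M`, linear in the parameter `t`, meets that orbit for all `t ≠ 0`
(`schubertSet_subset_closure`). The set is closed because inclusion in `N` is linear in the
coordinates of a frame (`isClosed_schubertSet`).

For connectedness, two points `M₁` and `g M₁` of an orbit are joined by the lattices `(1 + t (g -
1)) M₁`. This matrix lies in `GL(N)` for almost all `t`, so the orbit, and hence its closure, is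
irreducible. Both density arguments rest on `finite_setOf_line_notMem` and on `k` being infinite. -/

lemma u_zpow_coe (n : ℤ) : ((u k ^ n : k⸨X⸩ˣ) : k⸨X⸩) = HahnSeries.single n 1 := by
  rw [Units.val_zpow_eq_zpow_val]
  exact (RatFunc.single_zpow n).symm

lemma coeff_u_zpow_mul (n i : ℤ) (x : k⸨X⸩) :
    (((u k ^ n : k⸨X⸩ˣ) : k⸨X⸩) * x).coeff i = x.coeff (i - n) := by
  rw [u_zpow_coe, HahnSeries.coeff_single_mul, one_mul]

lemma mem_range_algebraMap_iff (x : k⸨X⸩) :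
    x ∈ Set.range (algebraMap k⟦X⟧ k⸨X⸩) ↔ ∀ i < 0, x.coeff i = 0 := by
  constructor
  · rintro ⟨y, rfl⟩ i hi
    rw [LaurentSeries.coe_algebraMap, PowerSeries.coeff_coe, if_pos hi]
  · intro h
    refine ⟨PowerSeries.mk fun n => x.coeff n, ?_⟩
    ext i
    rw [LaurentSeries.coe_algebraMap, PowerSeries.coeff_coe]
    split_ifs with hi
    · exact (h i hi).symm
    · rw [PowerSeries.coeff_mk, Int.natAbs_of_nonneg (not_lt.mp hi)]

lemma glSmul_toSubmodule (g : GL (Fin 2) k⸨X⸩) (L : GrLattice k) :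
    (g • L).toSubmodule = L.toSubmodule.map (glMap g) := rfl

lemma mulVec_mem_glSmul_iff (g : GL (Fin 2) k⸨X⸩) (L : GrLattice k) (v : Fin 2 → k⸨X⸩) :
    g.1.mulVec v ∈ (g • L).toSubmodule ↔ v ∈ L.toSubmodule := by
  constructor
  · rintro ⟨w, hw, h⟩
    rw [glMap_apply] at h
    have h2 := congrArg (g⁻¹).1.mulVec h
    rw [Matrix.mulVec_mulVec, Matrix.mulVec_mulVec, ← Units.val_mul, inv_mul_cancel,
      Units.val_one, Matrix.one_mulVec, Matrix.one_mulVec] at h2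
    exact h2 ▸ hw
  · exact fun h => ⟨v, h, rfl⟩

lemma mem_glSmul_iff (g : GL (Fin 2) k⸨X⸩) (L : GrLattice k) (v : Fin 2 → k⸨X⸩) :
    v ∈ (g • L).toSubmodule ↔ (g⁻¹).1.mulVec v ∈ L.toSubmodule := by
  rw [← mulVec_mem_glSmul_iff g L, Matrix.mulVec_mulVec, ← Units.val_mul, mul_inv_cancel,
    Units.val_one, Matrix.one_mulVec]

lemma glSmul_le_iff (g : GL (Fin 2) k⸨X⸩) (L M : GrLattice k) :
    (g • L).toSubmodule ≤ (g • M).toSubmodule ↔ L.toSubmodule ≤ M.toSubmodule := by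
  constructor
  · intro h v hv
    rw [← mulVec_mem_glSmul_iff g] at hv ⊢
    exact h hv
  · intro h v hv
    rw [mem_glSmul_iff] at hv ⊢
    exact h hv

lemma mem_unitSmul_iff (c : k⸨X⸩ˣ) (L : GrLattice k) (v : Fin 2 → k⸨X⸩) :
    v ∈ (c • L).toSubmodule ↔ (c⁻¹ : k⸨X⸩ˣ) • v ∈ L.toSubmodule := by
  constructor
  · rintro ⟨w, hw, rfl⟩
    change c⁻¹ • c • w ∈ _
    rwa [inv_smul_smul]
  · exact fun h => ⟨_, h, smul_inv_smul c v⟩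

lemma unitSmul_le_iff (c : k⸨X⸩ˣ) (L M : GrLattice k) :
    (c • L).toSubmodule ≤ (c • M).toSubmodule ↔ L.toSubmodule ≤ M.toSubmodule := by
  constructor
  · intro h v hv
    have := @h (c • v) (by rwa [mem_unitSmul_iff, inv_smul_smul])
    rwa [mem_unitSmul_iff, inv_smul_smul] at this
  · intro h v hv
    rw [mem_unitSmul_iff] at hv ⊢
    exact h hv

lemma gl_unit_smul_comm (g : GL (Fin 2) k⸨X⸩) (c : k⸨X⸩ˣ) (L : GrLattice k) :
    g • c • L = c • g • L := by
  apply GrLattice.ext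
  ext v
  rw [mem_glSmul_iff, mem_unitSmul_iff, mem_unitSmul_iff, mem_glSmul_iff]
  simp only [Units.smul_def, Matrix.mulVec_smul]

lemma mem_standardLattice_iff (v : Fin 2 → k⸨X⸩) :
    v ∈ (standardLattice k).toSubmodule ↔ ∀ a, ∀ i < 0, (v a).coeff i = 0 := by
  simp_rw [← mem_range_algebraMap_iff]
  constructor
  · intro h
    induction h using Submodule.span_induction with
    | mem x hx =>
      obtain ⟨i, rfl⟩ := hx
      intro a
      by_cases h : a = i
      · subst h; exact ⟨1, by simp⟩
      · exact ⟨0, by simp [h]⟩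
    | zero => exact fun a => ⟨0, by simp⟩
    | add x y _ _ hx hy =>
      intro a
      obtain ⟨s, hs⟩ := hx a
      obtain ⟨t, ht⟩ := hy a
      exact ⟨s + t, by rw [map_add, hs, ht]; rfl⟩
    | smul c x _ hx =>
      intro a
      obtain ⟨s, hs⟩ := hx a
      exact ⟨c * s, by rw [map_mul, hs, Pi.smul_apply, Algebra.smul_def]⟩
  · intro h
    choose c hc using h
    have : v = ∑ a, c a • Pi.single a (1 : k⸨X⸩) := by
      ext1 b
      rw [Finset.sum_apply, Finset.sum_eq_single b]
      · rw [Pi.smul_apply, Pi.single_eq_same, Algebra.smul_def, mul_one, hc]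
      · intro a _ hab
        rw [Pi.smul_apply, Pi.single_eq_of_ne hab.symm, smul_zero]
      · simp
    rw [this]
    exact Submodule.sum_mem _ fun a _ =>
      Submodule.smul_mem _ _ (Submodule.subset_span (Set.mem_range_self a))

/-- The diagonal matrix with entries `u ^ e a`. -/
def diagGL (k : Type*) [Field k] (e : Fin 2 → ℤ) : GL (Fin 2) k⸨X⸩ where
  val := Matrix.diagonal fun a => ((u k ^ e a : k⸨X⸩ˣ) : k⸨X⸩)
  inv := Matrix.diagonal fun a => ((u k ^ (-e a) : k⸨X⸩ˣ) : k⸨X⸩)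
  val_inv := by
    rw [Matrix.diagonal_mul_diagonal, ← Matrix.diagonal_one]
    congr 1
    ext1 a
    rw [← Units.val_mul, ← zpow_add, add_neg_cancel, zpow_zero, Units.val_one]
  inv_val := by
    rw [Matrix.diagonal_mul_diagonal, ← Matrix.diagonal_one]
    congr 1
    ext1 a
    rw [← Units.val_mul, ← zpow_add, neg_add_cancel, zpow_zero, Units.val_one]

/-- The lattice spanned by the multiples `u ^ e a` of the standard basis vectors. -/
def diagLattice (k : Type*) [Field k] (e : Fin 2 → ℤ) : GrLattice k :=
  diagGL k e • standardLattice k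

lemma mem_diagLattice_iff (e : Fin 2 → ℤ) (v : Fin 2 → k⸨X⸩) :
    v ∈ (diagLattice k e).toSubmodule ↔ ∀ a, ∀ i < e a, (v a).coeff i = 0 := by
  rw [diagLattice, mem_glSmul_iff, mem_standardLattice_iff]
  change (∀ a, ∀ i < 0, (Matrix.mulVec (Matrix.diagonal _) v a).coeff i = 0) ↔ _
  simp_rw [Matrix.mulVec_diagonal, coeff_u_zpow_mul]
  refine forall_congr' fun a => ⟨fun h i hi => ?_, fun h i hi => h _ (by omega)⟩
  simpa using h (i - e a) (by omega)

lemma diagLattice_le_iff (e f : Fin 2 → ℤ) :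
    (diagLattice k e).toSubmodule ≤ (diagLattice k f).toSubmodule ↔ f ≤ e := by
  constructor
  · intro h a
    by_contra! hlt
    have := h (x := Pi.single a (HahnSeries.single (e a) 1)) (by
      rw [mem_diagLattice_iff]
      intro b i hi
      by_cases hb : b = a
      · subst hb
        rw [Pi.single_eq_same, HahnSeries.coeff_single_of_ne hi.ne]
      · rw [Pi.single_eq_of_ne hb, HahnSeries.coeff_zero])
    rw [mem_diagLattice_iff] at this
    have := this a (e a) hlt
    simp at this
  · intro h v hv
    rw [mem_diagLattice_iff] at hv ⊢
    exact fun a i hi => hv a i (hi.trans_le (h a))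

lemma mem_zpow_smul_iff (n : ℤ) (e : Fin 2 → ℤ) (v : Fin 2 → k⸨X⸩) :
    v ∈ (u k ^ n • diagLattice k e).toSubmodule ↔ ∀ a, ∀ i < e a + n, (v a).coeff i = 0 := by
  rw [mem_unitSmul_iff, mem_diagLattice_iff, ← zpow_neg]
  simp_rw [Pi.smul_apply, Units.smul_def, smul_eq_mul, coeff_u_zpow_mul]
  refine forall_congr' fun a => ⟨fun h i hi => ?_, fun h i hi => h _ (by omega)⟩
  simpa using h (i - n) (by omega)

lemma zpow_smul_diagLattice (n : ℤ) (e : Fin 2 → ℤ) :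
    u k ^ n • diagLattice k e = diagLattice k fun a => e a + n := by
  apply GrLattice.ext
  ext v
  rw [mem_zpow_smul_iff, mem_diagLattice_iff]

lemma diagLattice_zero : diagLattice k (fun _ => 0) = standardLattice k := by
  apply GrLattice.ext
  ext v
  rw [mem_diagLattice_iff, mem_standardLattice_iff]

lemma zpow_smul_standardLattice (n : ℤ) :
    u k ^ n • standardLattice k = diagLattice k fun _ => n := by
  rw [← diagLattice_zero, zpow_smul_diagLattice]
  simp

/-! ### Bases of lattices -/

lemma exists_basis_matrix (N : GrLattice k)
    (b : Module.Basis (Fin 2) k⟦X⟧ N.toSubmodule) :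
    ∃ g : GL (Fin 2) k⸨X⸩, ∀ i, g.1.mulVec (Pi.single i 1) = b i := by
  have := N.isLattice
  have hli : LinearIndependent k⸨X⸩ fun i => (b i : Fin 2 → k⸨X⸩) := by
    have h := (b.extendOfIsLattice k⸨X⸩).linearIndependent
    rwa [funext (b.extendOfIsLattice_apply k⸨X⸩)] at h
  have hu : IsUnit (Matrix.of fun i j => (b j : Fin 2 → k⸨X⸩) i) :=
    Matrix.linearIndependent_cols_iff_isUnit.mp hli
  refine ⟨hu.unit, fun i => ?_⟩
  ext1 a
  rw [IsUnit.unit_spec, Matrix.mulVec_single_one]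
  rfl

lemma diagLattice_eq_span (e : Fin 2 → ℤ) : (diagLattice k e).toSubmodule =
    Submodule.span k⟦X⟧ (Set.range fun a : Fin 2 => (u k ^ e a) • Pi.single a (1 : k⸨X⸩)) := by
  rw [diagLattice, glSmul_toSubmodule, standardLattice, Submodule.map_span, ← Set.range_comp]
  congr 2
  ext1 a
  rw [Function.comp_apply, glMap_apply, Matrix.mulVec_single_one]
  ext1 b
  change Matrix.diagonal (fun a => ((u k ^ e a : k⸨X⸩ˣ) : k⸨X⸩)) b a = _
  rw [Matrix.diagonal_apply, Pi.smul_apply, Pi.single_apply, Units.smul_def]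
  split_ifs with h
  · simp [h]
  · simp

lemma span_coe_basis (N : GrLattice k) (b : Module.Basis (Fin 2) k⟦X⟧ N.toSubmodule) :
    Submodule.span k⟦X⟧ (Set.range fun i => (b i : Fin 2 → k⸨X⸩)) = N.toSubmodule := by
  have h := congrArg (Submodule.map N.toSubmodule.subtype) b.span_eq
  rw [Submodule.map_span, ← Set.range_comp, Submodule.map_top, Submodule.range_subtype] at h
  exact h

lemma exists_gl (L : GrLattice k) : ∃ g : GL (Fin 2) k⸨X⸩, L = g • standardLattice k := by
  have := L.isLattice
  obtain ⟨g, hg⟩ := exists_basis_matrix L (Module.finBasisOfFinrankEq k⟦X⟧ L.toSubmodule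
    (by rw [Submodule.IsLattice.finrank_of_pi k⸨X⸩, Fintype.card_fin]))
  refine ⟨g, GrLattice.ext ?_⟩
  rw [glSmul_toSubmodule, standardLattice, Submodule.map_span, ← Set.range_comp,
    ← span_coe_basis]
  congr 2
  ext1 i
  rw [Function.comp_apply, glMap_apply, hg]

lemma exists_forall_coeff_eq_zero (x : k⸨X⸩) : ∃ n : ℕ, ∀ i < -(n : ℤ), x.coeff i = 0 :=
  ⟨x.order.natAbs, fun _ hi => HahnSeries.coeff_eq_zero_of_lt_order (by omega)⟩

lemma exists_le_zpow_smul (M N : GrLattice k) :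
    ∃ n : ℕ, ∀ m : ℕ, n ≤ m → M.toSubmodule ≤ (u k ^ (-(m : ℤ)) • N).toSubmodule := by
  obtain ⟨g, rfl⟩ := exists_gl N
  obtain ⟨h, hh⟩ := exists_gl (g⁻¹ • M)
  rw [inv_smul_eq_iff] at hh
  subst hh
  choose n hn using fun a b => exists_forall_coeff_eq_zero (h.1 a b)
  refine ⟨∑ a, ∑ b, n a b, fun m hm => ?_⟩
  rw [← gl_unit_smul_comm, glSmul_le_iff, glSmul_toSubmodule, standardLattice,
    Submodule.map_span, Submodule.span_le]
  rintro _ ⟨_, ⟨b, rfl⟩, rfl⟩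
  change _ ∈ (u k ^ (-(m : ℤ)) • standardLattice k).toSubmodule
  rw [zpow_smul_standardLattice, mem_diagLattice_iff, glMap_apply, Matrix.mulVec_single_one]
  intro a i hi
  refine hn a b i (hi.trans_le ?_)
  have h1 : n a b ≤ ∑ b, n a b := Finset.single_le_sum (fun _ _ => Nat.zero_le _) (Finset.mem_univ b)
  have h2 : ∑ b, n a b ≤ ∑ a, ∑ b, n a b :=
    Finset.single_le_sum (f := fun a => ∑ b, n a b) (fun _ _ => Nat.zero_le _) (Finset.mem_univ a)
  omega

/-- Smith normal form over the discrete valuation ring `k⟦X⟧`, whose nonzero elements are units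
times powers of the uniformizer. -/
lemma exists_adapted_of_le (M N : GrLattice k) (h : M.toSubmodule ≤ N.toSubmodule) :
    ∃ (g : GL (Fin 2) k⸨X⸩) (e : Fin 2 → ℤ), e 1 ≤ e 0 ∧
      N = g • standardLattice k ∧ M = g • diagLattice k e := by
  have := N.isLattice
  have := M.isLattice
  have hN : Module.finrank k⟦X⟧ N.toSubmodule = 2 := by
    rw [Submodule.IsLattice.finrank_of_pi k⸨X⸩, Fintype.card_fin]
  have hM : Module.finrank k⟦X⟧ M.toSubmodule = 2 := by
    rw [Submodule.IsLattice.finrank_of_pi k⸨X⸩, Fintype.card_fin]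
  obtain ⟨b, a, b', hb⟩ := Submodule.exists_smith_normal_form_of_rank_eq
    (Module.finBasisOfFinrankEq k⟦X⟧ N.toSubmodule hN)
    (N := M.toSubmodule.comap N.toSubmodule.subtype)
    (by rw [(Submodule.comapSubtypeEquivOfLe h).finrank_eq, hN, hM])
  have ha : ∀ i, a i ≠ 0 := fun i hi => b'.ne_zero i (Subtype.coe_injective (by simp [hb, hi]))
  choose n hn using fun i => IsDiscreteValuationRing.associated_pow_irreducible (ha i)
    (PowerSeries.X_irreducible (R := k))
  -- The basis is reordered so that the larger exponent comes first.
  obtain ⟨σ, hσ⟩ : ∃ σ : Equiv.Perm (Fin 2), n (σ 1) ≤ n (σ 0) := by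
    rcases le_total (n 1) (n 0) with h | h
    · exact ⟨1, h⟩
    · exact ⟨Equiv.swap 0 1, by simpa using h⟩
  obtain ⟨g, hg⟩ := exists_basis_matrix N (b.reindex σ.symm)
  refine ⟨g, fun i => n (σ i), Int.ofNat_le.mpr hσ, GrLattice.ext ?_, GrLattice.ext ?_⟩
  · rw [glSmul_toSubmodule, standardLattice, Submodule.map_span, ← Set.range_comp,
      ← span_coe_basis N (b.reindex σ.symm)]
    congr 2
    ext1 i
    rw [Function.comp_apply, glMap_apply, hg]
  · rw [glSmul_toSubmodule, diagLattice_eq_span, Submodule.map_span, ← Set.range_comp]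
    have hM' := span_coe_basis M ((b'.map (Submodule.comapSubtypeEquivOfLe h)).reindex σ.symm)
    rw [← hM']
    have key : ∀ i, Associated (a (σ i)) (PowerSeries.X ^ n (σ i)) := fun i => hn (σ i)
    choose c hc using key
    have hu : ∀ m : ℕ, (u k ^ (m : ℤ)).1 = algebraMap k⟦X⟧ k⸨X⸩ (PowerSeries.X ^ m) := by
      intro m
      rw [u_zpow_coe, LaurentSeries.coe_algebraMap, HahnSeries.ofPowerSeries_X_pow]
    have e1 : ∀ i, (glMap g) ((u k ^ (n (σ i) : ℤ)) • Pi.single i (1 : k⸨X⸩)) =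
        (c i : k⟦X⟧) • (((b'.map (Submodule.comapSubtypeEquivOfLe h)).reindex σ.symm) i :
          Fin 2 → k⸨X⸩) := by
      intro i
      have e2 : (((b'.map (Submodule.comapSubtypeEquivOfLe h)).reindex σ.symm) i :
          Fin 2 → k⸨X⸩) = a (σ i) • (b (σ i) : Fin 2 → k⸨X⸩) := by
        rw [Module.Basis.reindex_apply, Equiv.symm_symm, Module.Basis.map_apply,
          Submodule.comapSubtypeEquivOfLe_apply_coe, hb]
        rfl
      have e3 : (b (σ i) : Fin 2 → k⸨X⸩) = g.1.mulVec (Pi.single i 1) := by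
        rw [hg, Module.Basis.reindex_apply, Equiv.symm_symm]
      rw [e2, smul_smul, mul_comm, hc, e3, Units.smul_def, glMap_apply, Matrix.mulVec_smul, hu,
        algebraMap_smul]
    simp only [Function.comp_def]
    simp_rw [e1]
    apply le_antisymm
    · rw [Submodule.span_le]
      rintro _ ⟨i, rfl⟩
      have := Submodule.smul_mem _ ((c i)⁻¹).1
        (Submodule.subset_span (R := k⟦X⟧) (Set.mem_range_self (f := fun i => (c i : k⟦X⟧) •
          (((b'.map (Submodule.comapSubtypeEquivOfLe h)).reindex σ.symm) i : Fin 2 → k⸨X⸩)) i))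
      simpa only [smul_smul, Units.inv_mul, one_smul, SetLike.mem_coe] using this
    · rw [Submodule.span_le]
      rintro _ ⟨i, rfl⟩
      exact Submodule.smul_mem _ _ (Submodule.subset_span ⟨i, rfl⟩)

/-- Elementary divisors: any two lattices have adapted bases. -/
lemma exists_adapted (M N : GrLattice k) :
    ∃ (g : GL (Fin 2) k⸨X⸩) (e : Fin 2 → ℤ), e 1 ≤ e 0 ∧
      N = g • standardLattice k ∧ M = g • diagLattice k e := by
  obtain ⟨n, hn⟩ := exists_le_zpow_smul M N
  obtain ⟨g, e, he, hN, hM⟩ := exists_adapted_of_le (u k ^ (n : ℤ) • M) N (by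
    rw [← unitSmul_le_iff (u k ^ (-(n : ℤ))), smul_smul, ← zpow_add, neg_add_cancel, zpow_zero,
      one_smul]
    exact hn n le_rfl)
  refine ⟨g, fun a => e a + -n, by simpa using he, hN, ?_⟩
  rw [← zpow_smul_diagLattice, gl_unit_smul_comm, ← hM, smul_smul, ← zpow_add, neg_add_cancel,
    zpow_zero, one_smul]

/-! ### Determinants -/

lemma det_standardLattice : (standardLattice k).det = Submodule.span k⟦X⟧ {1} := by
  apply le_antisymm
  · rw [GrLattice.det, Submodule.span_le]
    rintro _ ⟨v, hv, w, hw, rfl⟩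
    rw [mem_standardLattice_iff] at hv hw
    simp_rw [← mem_range_algebraMap_iff] at hv hw
    choose a ha using hv
    choose b hb using hw
    rw [SetLike.mem_coe, Submodule.mem_span_singleton]
    refine ⟨a 0 * b 1 - a 1 * b 0, ?_⟩
    rw [Matrix.det_fin_two, Algebra.smul_def, mul_one, map_sub, map_mul, map_mul]
    simp [← ha, ← hb]
  · rw [Submodule.span_singleton_le_iff_mem]
    refine Submodule.subset_span ⟨Pi.single 0 1, Submodule.subset_span ⟨0, rfl⟩, Pi.single 1 1,
      Submodule.subset_span ⟨1, rfl⟩, ?_⟩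
    rw [Matrix.det_fin_two]
    simp

lemma det_glSmul (g : GL (Fin 2) k⸨X⸩) (L : GrLattice k) :
    (g • L).det = L.det.map ((LinearMap.mulLeft k⸨X⸩ g.1.det).restrictScalars k⟦X⟧) := by
  rw [GrLattice.det, GrLattice.det, Submodule.map_span]
  congr 1
  have key : ∀ v w : Fin 2 → k⸨X⸩,
      Matrix.det (Matrix.of ![g.1.mulVec v, g.1.mulVec w]) =
        g.1.det * Matrix.det (Matrix.of ![v, w]) := by
    intro v w
    simp only [Matrix.det_fin_two, Matrix.of_apply, Matrix.cons_val_zero, Matrix.cons_val_one,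
      Matrix.mulVec, dotProduct, Fin.sum_univ_two]
    ring
  ext d
  constructor
  · rintro ⟨_, ⟨v, hv, rfl⟩, _, ⟨w, hw, rfl⟩, rfl⟩
    exact ⟨_, ⟨v, hv, w, hw, rfl⟩, (key v w).symm⟩
  · rintro ⟨_, ⟨v, hv, w, hw, rfl⟩, rfl⟩
    exact ⟨_, ⟨v, hv, rfl⟩, _, ⟨w, hw, rfl⟩, (key v w).symm⟩

lemma det_glSmul_of_det_eq (g : GL (Fin 2) k⸨X⸩) {L : GrLattice k} {d : k⸨X⸩}
    (hL : L.det = Submodule.span k⟦X⟧ {d}) :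
    (g • L).det = Submodule.span k⟦X⟧ {g.1.det * d} := by
  rw [det_glSmul, hL, Submodule.map_span, Set.image_singleton]
  rfl

lemma det_diagLattice (e : Fin 2 → ℤ) :
    (diagLattice k e).det =
      Submodule.span k⟦X⟧ {((u k ^ (e 0 + e 1) : k⸨X⸩ˣ) : k⸨X⸩)} := by
  rw [diagLattice, det_glSmul_of_det_eq _ det_standardLattice, diagGL, Matrix.det_diagonal,
    Fin.prod_univ_two, mul_one, zpow_add, Units.val_mul]

lemma span_u_zpow_le_iff {m n : ℤ} :
    Submodule.span k⟦X⟧ {((u k ^ m : k⸨X⸩ˣ) : k⸨X⸩)} ≤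
      Submodule.span k⟦X⟧ {((u k ^ n : k⸨X⸩ˣ) : k⸨X⸩)} ↔ n ≤ m := by
  rw [Submodule.span_singleton_le_iff_mem, Submodule.mem_span_singleton]
  constructor
  · rintro ⟨a, ha⟩
    by_contra! hlt
    have h1 := congrArg (fun x => HahnSeries.coeff x m) ha
    rw [Algebra.smul_def, mul_comm] at h1
    simp only [coeff_u_zpow_mul] at h1
    rw [u_zpow_coe, HahnSeries.coeff_single_same,
      (mem_range_algebraMap_iff _).mp ⟨a, rfl⟩ _ (by omega)] at h1
    exact zero_ne_one h1
  · intro h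
    obtain ⟨j, rfl⟩ := Int.le.dest h
    refine ⟨PowerSeries.X ^ j, ?_⟩
    rw [Algebra.smul_def, LaurentSeries.coe_algebraMap, HahnSeries.ofPowerSeries_X_pow,
      ← u_zpow_coe, ← Units.val_mul, ← zpow_add, add_comm]

lemma span_u_zpow_inj {m n : ℤ} :
    Submodule.span k⟦X⟧ {((u k ^ m : k⸨X⸩ˣ) : k⸨X⸩)} =
      Submodule.span k⟦X⟧ {((u k ^ n : k⸨X⸩ˣ) : k⸨X⸩)} ↔ m = n := by
  rw [le_antisymm_iff, span_u_zpow_le_iff, span_u_zpow_le_iff]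
  omega

lemma exists_span_singleton_eq {x : k⸨X⸩} (hx : x ≠ 0) :
    ∃ m : ℤ, Submodule.span k⟦X⟧ {x} =
      Submodule.span k⟦X⟧ {((u k ^ m : k⸨X⸩ˣ) : k⸨X⸩)} := by
  have hu : IsUnit x.powerSeriesPart := by
    rw [PowerSeries.isUnit_iff_constantCoeff, ← PowerSeries.coeff_zero_eq_constantCoeff_apply,
      LaurentSeries.powerSeriesPart_coeff, isUnit_iff_ne_zero, Nat.cast_zero, add_zero]
    exact HahnSeries.coeff_order_eq_zero.not.mpr hx
  refine ⟨x.order, ?_⟩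
  rw [← Submodule.span_singleton_smul_eq hu (u k ^ x.order).1, Algebra.smul_def, LaurentSeries.coe_algebraMap,
    mul_comm, u_zpow_coe, LaurentSeries.single_order_mul_powerSeriesPart]

lemma exists_det_eq (L : GrLattice k) :
    ∃ m : ℤ, L.det = Submodule.span k⟦X⟧ {((u k ^ m : k⸨X⸩ˣ) : k⸨X⸩)} := by
  obtain ⟨g, rfl⟩ := exists_gl L
  rw [det_glSmul_of_det_eq _ det_standardLattice, mul_one]
  exact exists_span_singleton_eq ((Matrix.isUnit_iff_isUnit_det _).mp g.isUnit).ne_zero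

/-- The valuation of the determinant of a lattice. -/
def GrLattice.detVal (L : GrLattice k) : ℤ := (exists_det_eq L).choose

lemma det_eq_iff {L : GrLattice k} {m : ℤ} :
    L.det = Submodule.span k⟦X⟧ {((u k ^ m : k⸨X⸩ˣ) : k⸨X⸩)} ↔ L.detVal = m := by
  rw [(exists_det_eq L).choose_spec, span_u_zpow_inj]
  rfl

lemma detVal_eq_iff {L M : GrLattice k} : L.detVal = M.detVal ↔ L.det = M.det := by
  rw [← det_eq_iff, ← det_eq_iff.mpr (rfl : M.detVal = M.detVal)]

lemma exists_detVal_glSmul (g : GL (Fin 2) k⸨X⸩) :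
    ∃ c : ℤ, ∀ L : GrLattice k, (g • L).detVal = L.detVal + c := by
  obtain ⟨c, hc⟩ := exists_span_singleton_eq
    ((Matrix.isUnit_iff_isUnit_det _).mp g.isUnit).ne_zero
  refine ⟨c, fun L => det_eq_iff.mp ?_⟩
  rw [det_glSmul_of_det_eq g (det_eq_iff.mpr rfl), zpow_add, Units.val_mul, mul_comm]
  have h := congrArg (Submodule.map ((LinearMap.mulLeft k⸨X⸩
    (u k ^ L.detVal).1).restrictScalars k⟦X⟧)) hc
  rwa [Submodule.map_span, Submodule.map_span, Set.image_singleton, Set.image_singleton] at h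

lemma detVal_diagLattice (e : Fin 2 → ℤ) : (diagLattice k e).detVal = e 0 + e 1 :=
  det_eq_iff.mp (det_diagLattice e)

lemma detVal_standardLattice : (standardLattice k).detVal = 0 := by
  rw [← diagLattice_zero, detVal_diagLattice, add_zero]

lemma detVal_glSmul_diagLattice (g : GL (Fin 2) k⸨X⸩) (e : Fin 2 → ℤ) :
    (g • diagLattice k e).detVal = (g • standardLattice k).detVal + (e 0 + e 1) := by
  obtain ⟨c, hc⟩ := exists_detVal_glSmul g
  rw [hc, hc, detVal_diagLattice, detVal_standardLattice]
  ring

lemma detVal_le_of_le {L M : GrLattice k} (h : L.toSubmodule ≤ M.toSubmodule) :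
    M.detVal ≤ L.detVal := by
  obtain ⟨g, e, -, rfl, rfl⟩ := exists_adapted L M
  rw [← diagLattice_zero, glSmul_le_iff, diagLattice_le_iff] at h
  rw [detVal_glSmul_diagLattice]
  have h0 : 0 ≤ e 0 := h 0
  have h1 : 0 ≤ e 1 := h 1
  omega

lemma zpow_smul_le_zpow_smul_iff (L : GrLattice k) {m n : ℤ} :
    (u k ^ m • L).toSubmodule ≤ (u k ^ n • L).toSubmodule ↔ n ≤ m := by
  obtain ⟨g, rfl⟩ := exists_gl L
  rw [← gl_unit_smul_comm, ← gl_unit_smul_comm, glSmul_le_iff, zpow_smul_standardLattice,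
    zpow_smul_standardLattice, diagLattice_le_iff]
  exact ⟨fun h => h 0, fun h _ => h⟩


/-! ### Distances in the tree -/

/-- The lattice `c • L` depends only on the fractional ideal generated by `c`, and every such ideal
is generated by a power of `u`. -/
lemma exists_zpow_smul_eq (c : k⸨X⸩ˣ) (L : GrLattice k) : ∃ n : ℤ, c • L = u k ^ n • L := by
  obtain ⟨n, hn⟩ := exists_span_singleton_eq c.ne_zero
  refine ⟨n, ?_⟩
  have key : ∀ {c d : k⸨X⸩ˣ}, Submodule.span k⟦X⟧ {c.1} ≤ Submodule.span k⟦X⟧ {d.1} →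
      (c • L).toSubmodule ≤ (d • L).toSubmodule := by
    intro c d h v hv
    rw [mem_unitSmul_iff] at hv ⊢
    obtain ⟨a, ha⟩ := Submodule.mem_span_singleton.mp
      ((Submodule.span_singleton_le_iff_mem _ _).mp h)
    have : d⁻¹ • v = a • c⁻¹ • v := by
      rw [Algebra.smul_def] at ha
      rw [inv_smul_eq_iff]
      ext1 b
      rw [Pi.smul_apply, Pi.smul_apply, Pi.smul_apply, Units.smul_def, Units.smul_def,
        Algebra.smul_def a, smul_eq_mul, smul_eq_mul, ← mul_assoc, ← mul_assoc,
        mul_comm d.1, ha, Units.mul_inv, one_mul]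
    rw [this]
    exact Submodule.smul_mem _ _ hv
  exact GrLattice.ext (le_antisymm (key hn.le) (key hn.ge))

lemma vertex_eq_iff {M N : GrLattice k} : M.vertex = N.vertex ↔ ∃ n : ℤ, M = u k ^ n • N := by
  refine Quotient.eq.trans ?_
  constructor
  · rintro ⟨c, rfl⟩
    exact exists_zpow_smul_eq c N
  · rintro ⟨n, rfl⟩
    exact ⟨_, rfl⟩

lemma exists_vertex_eq (v : Vertex k) : ∃ M : GrLattice k, M.vertex = v :=
  Quotient.exists_rep v

lemma exists_le_of_adj {v w : Vertex k} (h : (tree k).Adj v w) :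
    ∃ M N : GrLattice k, M.vertex = v ∧ N.vertex = w ∧
      (u k ^ (1 : ℤ) • M).toSubmodule ≤ N.toSubmodule ∧ N.toSubmodule ≤ M.toSubmodule := by
  rw [tree, SimpleGraph.fromRel_adj] at h
  obtain ⟨-, ⟨M, N, hM, hN, h1, h2⟩ | ⟨N, M, hN, hM, h1, h2⟩⟩ := h
  · exact ⟨M, N, hM, hN, by rwa [zpow_one], h2⟩
  -- The relation is symmetric up to homothety: `u N ⊆ M ⊆ N` gives `u M ⊆ u N ⊆ M`.
  · refine ⟨M, u k ^ (1 : ℤ) • N, hM, ?_, by rwa [unitSmul_le_iff], by rwa [zpow_one]⟩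
    rw [← hN, vertex_eq_iff]
    exact ⟨1, rfl⟩

/-- Each edge widens the gap between the two bounds by one power of `u`. This yields the lower bound
for distances in `dist_vertex`. -/
lemma exists_zpow_smul_le_of_walk {v w : Vertex k} (p : (tree k).Walk v w) :
    ∀ M N : GrLattice k, M.vertex = v → N.vertex = w →
      ∃ j : ℤ, (u k ^ (j + p.length) • N).toSubmodule ≤ M.toSubmodule ∧
        M.toSubmodule ≤ (u k ^ j • N).toSubmodule := by
  induction p with
  | nil =>
    intro M N hM hN
    obtain ⟨n, rfl⟩ := vertex_eq_iff.mp (hM.trans hN.symm)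
    exact ⟨n, by simp, le_rfl⟩
  | cons h p ih =>
    intro M N hM hN
    obtain ⟨M₁, M₂, h1, h2, hle, hle'⟩ := exists_le_of_adj h
    obtain ⟨n, rfl⟩ := vertex_eq_iff.mp (hM.trans h1.symm)
    obtain ⟨j, hj, hj'⟩ := ih (u k ^ n • M₂) N (by rw [← h2, vertex_eq_iff]; exact ⟨n, rfl⟩) hN
    refine ⟨j - 1, ?_, ?_⟩
    · refine le_trans (le_trans ?_ hj) ((unitSmul_le_iff _ _ _).mpr hle')
      rw [SimpleGraph.Walk.length_cons, zpow_smul_le_zpow_smul_iff]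
      push_cast
      omega
    · rw [← unitSmul_le_iff (u k ^ (1 : ℤ)), smul_smul _ _ N, ← zpow_add, add_sub_cancel,
        smul_smul, mul_comm, ← smul_smul]
      exact le_trans ((unitSmul_le_iff _ _ _).mpr hle) hj'

/-- The walk lowers the first exponent by one at a time, which gives the upper bound for distances.
-/
lemma exists_walk (g : GL (Fin 2) k⸨X⸩) (f : ℤ) (i : ℕ) :
    ∃ p : (tree k).Walk (g • diagLattice k ![f + i, f]).vertex (g • standardLattice k).vertex,
      p.length ≤ i := by
  induction i with
  | zero =>
    have : (g • diagLattice k ![f + (0 : ℕ), f]).vertex = (g • standardLattice k).vertex := by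
      rw [vertex_eq_iff]
      refine ⟨f, ?_⟩
      rw [← gl_unit_smul_comm, zpow_smul_standardLattice]
      congr 2
      ext a
      fin_cases a <;> simp
    rw [this]
    exact ⟨SimpleGraph.Walk.nil, le_rfl⟩
  | succ i ih =>
    obtain ⟨p, hp⟩ := ih
    -- As only an upper bound on the length is claimed, a coincidence of consecutive vertices need
    -- not be excluded.
    by_cases heq : (g • diagLattice k ![f + (i + 1 : ℕ), f]).vertex =
        (g • diagLattice k ![f + i, f]).vertex
    · rw [heq]
      exact ⟨p, by omega⟩
    · refine ⟨SimpleGraph.Walk.cons (?_ : (tree k).Adj _ _) p,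
        by rw [SimpleGraph.Walk.length_cons]; omega⟩
      rw [tree, SimpleGraph.fromRel_adj]
      refine ⟨heq, Or.inr ⟨_, _, rfl, rfl, ?_, ?_⟩⟩
      · rw [← zpow_one (u k), ← gl_unit_smul_comm, zpow_smul_diagLattice, glSmul_le_iff,
          diagLattice_le_iff]
        intro a
        fin_cases a <;> simp [add_assoc]
      · rw [glSmul_le_iff, diagLattice_le_iff]
        intro a
        fin_cases a <;> simp

lemma dist_vertex (g : GL (Fin 2) k⸨X⸩) (e : Fin 2 → ℤ) (he : e 1 ≤ e 0) :
    ((tree k).dist (g • diagLattice k e).vertex (g • standardLattice k).vertex : ℤ) =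
      e 0 - e 1 := by
  obtain ⟨i, hi⟩ := Int.le.dest he
  have he' : e = ![e 1 + i, e 1] := by
    ext a
    fin_cases a
    · exact hi.symm
    · rfl
  obtain ⟨p, hp⟩ : ∃ p : (tree k).Walk (g • diagLattice k e).vertex
      (g • standardLattice k).vertex, p.length ≤ i := by
    have := exists_walk g (e 1) i
    rwa [← he'] at this
  apply le_antisymm
  · have := SimpleGraph.dist_le p
    omega
  -- The walk `p` is needed here too: `dist` is `0` by default between unconnected vertices.
  · obtain ⟨q, hq⟩ := p.reachable.exists_walk_length_eq_dist
    obtain ⟨j, h1, h2⟩ := exists_zpow_smul_le_of_walk q _ _ rfl rfl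
    rw [← gl_unit_smul_comm, glSmul_le_iff, zpow_smul_standardLattice, diagLattice_le_iff]
      at h1 h2
    have h3 : e 0 ≤ j + q.length := h1 0
    have h4 : j ≤ e 1 := h2 1
    omega

/-- In adapted bases the inclusion in `u ^ j N` says `j ≤ e 1`. Since `e 0 - e 1 = (e 0 + e 1) - 2 *
e 1` and the sum is the difference of the determinant valuations, this is a bound on the distance;
the floor division takes care of parity. For `ρ < 0` both sides are false. -/
lemma dist_vertex_le_iff (M N : GrLattice k) (ρ : ℤ) :
    ((tree k).dist M.vertex N.vertex : ℤ) ≤ ρ ↔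
      M.toSubmodule ≤ (u k ^ (-((ρ + N.detVal - M.detVal) / 2)) • N).toSubmodule := by
  obtain ⟨g, e, he, rfl, rfl⟩ := exists_adapted M N
  rw [dist_vertex g e he, ← gl_unit_smul_comm, glSmul_le_iff, zpow_smul_standardLattice,
    diagLattice_le_iff, detVal_glSmul_diagLattice, Pi.le_def, Fin.forall_fin_two]
  omega

end AffGr

/-! ### Distances in the geometric realization -/

namespace AffGr.Realization

variable {V : Type*} {G : SimpleGraph V}

lemma coord_support_nonempty (x : Realization G) : x.coord.support.Nonempty := by
  by_contra h
  rw [Finset.not_nonempty_iff_eq_empty, Finsupp.support_eq_empty] at h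
  have := x.sum_eq_one
  rw [h, Finsupp.sum_zero_index] at this
  exact zero_ne_one this

lemma exists_support_subset (x : Realization G) {v a b : V} (h : a = b ∨ G.Adj a b)
    (hv : v ∈ ({a, b} : Set V)) (hx : (x.coord.support : Set V) ⊆ {a, b}) :
    ∃ c, (v = c ∨ G.Adj v c) ∧ (x.coord.support : Set V) ⊆ {v, c} := by
  rcases hv with rfl | rfl
  · exact ⟨b, h, hx⟩
  · exact ⟨a, h.imp Eq.symm SimpleGraph.Adj.symm, by rwa [Set.pair_comm]⟩

/-- A point of the geometric realization in an edge of `v` is determined by its `v`-coordinate. -/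
lemma half_sum_abs_le_iff (x : Realization G) {v c : V} (h : v = c ∨ G.Adj v c)
    (hx : (x.coord.support : Set V) ⊆ {v, c}) (r : ℝ) :
    (1 / 2) * ((Finsupp.single v 1 - x.coord).sum fun _ t => |t|) ≤ r ↔
      ∃ b ∈ x.coord.support, (G.dist v b : ℝ) + (1 - x.coord b) ≤ r := by
  classical
  rcases h with rfl | h
  · rw [Set.pair_eq_singleton] at hx
    have hx' : x.coord = Finsupp.single v (x.coord v) := by
      ext w
      rw [Finsupp.single_apply]
      split_ifs with hw
      · rw [hw]
      · by_contra h0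
        exact hw (Set.mem_singleton_iff.mp (hx (Finset.mem_coe.mpr
          (Finsupp.mem_support_iff.mpr h0)))).symm
    have h1 : x.coord v = 1 := by
      have := x.sum_eq_one
      rwa [hx', Finsupp.sum_single_index rfl] at this
    rw [h1] at hx'
    rw [hx', sub_self, Finsupp.sum_zero_index, Finsupp.support_single _ one_ne_zero]
    simp
  · have hsupp : x.coord.support ⊆ {v, c} := by
      intro w hw
      simpa using hx (Finset.mem_coe.mpr hw)
    have h1 : x.coord v + x.coord c = 1 := by
      have := x.sum_eq_one
      rwa [Finsupp.sum_of_support_subset _ hsupp _ (fun _ _ => rfl), Finset.sum_pair h.ne] at this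
    have h2 : ((Finsupp.single v 1 - x.coord).sum fun _ t => |t|) = 2 * (1 - x.coord v) := by
      have hs : (Finsupp.single v (1 : ℝ) - x.coord).support ⊆ {v, c} := by
        refine Finsupp.support_sub.trans (Finset.union_subset ?_ hsupp)
        exact Finsupp.support_single_subset.trans (by simp)
      rw [Finsupp.sum_of_support_subset _ hs _ (fun _ _ => abs_zero), Finset.sum_pair h.ne,
        Finsupp.sub_apply, Finsupp.sub_apply, Finsupp.single_eq_same,
        Finsupp.single_eq_of_ne h.ne', zero_sub, abs_neg, abs_of_nonneg (x.nonneg c),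
        abs_of_nonneg (by linarith [x.nonneg c])]
      linarith
    have hd : (G.dist v c : ℝ) = 1 := by
      exact_mod_cast SimpleGraph.dist_eq_one_iff_adj.mpr h
    rw [h2]
    constructor
    · intro hr
      by_cases hv : v ∈ x.coord.support
      · exact ⟨v, hv, by rw [SimpleGraph.dist_self, Nat.cast_zero]; linarith⟩
      -- Here `x` is the vertex `c`, at distance `1` from `v`.
      · rw [Finsupp.notMem_support_iff] at hv
        refine ⟨c, by rw [Finsupp.mem_support_iff]; intro h0; linarith, ?_⟩
        rw [hd]
        linarith
    · rintro ⟨b, hb, hr⟩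
      have hb' := hsupp hb
      rw [Finset.mem_insert, Finset.mem_singleton] at hb'
      rcases hb' with rfl | rfl
      · rw [SimpleGraph.dist_self, Nat.cast_zero] at hr
        linarith
      · rw [hd] at hr
        linarith [x.nonneg v]

/-- Both branches of the definition of the distance reduce to a minimum over the vertices supporting
`x`; in the second branch the infimum is attained because it is over a finite nonempty set. -/
lemma dist_ofVertex_le_iff (v : V) (x : Realization G) (r : ℝ) :
    (ofVertex G v).dist x ≤ r ↔
      ∃ b ∈ x.coord.support, (G.dist v b : ℝ) + (1 - x.coord b) ≤ r := by
  classical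
  have hsupp : (ofVertex G v).coord.support = {v} := Finsupp.support_single _ one_ne_zero
  rw [Realization.dist]
  split_ifs with h
  · obtain ⟨a, b, hab, hv, hx⟩ := h
    obtain ⟨c, hc, hxc⟩ := exists_support_subset x hab (hv (a := v) (by rw [hsupp]; simp)) hx
    exact half_sum_abs_le_iff x hc hxc r
  · have hv : v ∈ (ofVertex G v).coord.support := by rw [hsupp]; simp
    have h1 : (ofVertex G v).coord v = 1 := Finsupp.single_eq_same
    obtain ⟨b₀, hb₀⟩ := x.coord_support_nonempty
    have : Nonempty ((ofVertex G v).coord.support × x.coord.support) := ⟨⟨v, hv⟩, ⟨b₀, hb₀⟩⟩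
    constructor
    · intro hr
      obtain ⟨⟨⟨a, ha⟩, ⟨b, hb⟩⟩, he⟩ := exists_eq_ciInf_of_finite
        (f := fun e : (ofVertex G v).coord.support × x.coord.support =>
          (1 - (ofVertex G v).coord e.1) + (G.dist (e.1 : V) (e.2 : V) : ℝ) + (1 - x.coord e.2))
      rw [← he] at hr
      obtain rfl : a = v := by rw [hsupp] at ha; simpa using ha
      refine ⟨b, hb, ?_⟩
      simp only [h1] at hr
      linarith
    · rintro ⟨b, hb, hr⟩
      refine (ciInf_le (Set.finite_range _).bddBelow
        (⟨⟨v, hv⟩, ⟨b, hb⟩⟩ : (ofVertex G v).coord.support × x.coord.support)).trans ?_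
      simp only [h1]
      linarith

end AffGr.Realization

/-! ### Balls in the building as inclusion conditions -/

namespace AffGr

variable {k : Type*} [Field k]

/-- On lattices with a fixed determinant, a ball around a vertex is cut out by an inclusion. -/
lemma exists_dist_vertex_le_iff (m : ℤ) (b : Vertex k) (N : GrLattice k) (hN : N.vertex = b)
    (s : ℝ) : ∃ j : ℤ, ∀ M : GrLattice k, M.detVal = m →
      (((tree k).dist M.vertex b : ℝ) ≤ s ↔
        M.toSubmodule ≤ (u k ^ j • N).toSubmodule) := by
  -- Graph distances are integers, so `s` may be replaced by its floor; the exponent of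
  -- `dist_vertex_le_iff` involves `M` only through `m`.
  refine ⟨-((⌊s⌋ + N.detVal - m) / 2), fun M hM => ?_⟩
  subst hN hM
  rw [← dist_vertex_le_iff, Int.le_floor, Int.cast_natCast]

lemma zpow_smul_total {M N : GrLattice k}
    (h1 : (u k ^ (1 : ℤ) • M).toSubmodule ≤ N.toSubmodule)
    (h2 : N.toSubmodule ≤ M.toSubmodule) (i j : ℤ) :
    (u k ^ i • M).toSubmodule ≤ (u k ^ j • N).toSubmodule ∨
      (u k ^ j • N).toSubmodule ≤ (u k ^ i • M).toSubmodule := by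
  rcases le_or_gt i j with h | h
  · exact Or.inr (((unitSmul_le_iff _ _ _).mpr h2).trans
      ((zpow_smul_le_zpow_smul_iff M).mpr h))
  · left
    refine ((zpow_smul_le_zpow_smul_iff M).mpr (Int.add_one_le_of_lt h)).trans ?_
    rw [zpow_add, ← smul_smul, unitSmul_le_iff]
    exact h1

/-- On lattices with a fixed determinant, a ball in the building is cut out by an inclusion. -/
lemma exists_dist_point_le_iff (m : ℤ) (x : Building k) (r : ℝ) :
    ∃ L : GrLattice k, ∀ M : GrLattice k, M.detVal = m →
      (M.point.dist x ≤ r ↔ M.toSubmodule ≤ L.toSubmodule) := by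
  obtain ⟨a, b, hab, hx⟩ := x.support_subset
  obtain ⟨A, B, hA, hB, h1, h2⟩ : ∃ A B : GrLattice k, A.vertex = a ∧ B.vertex = b ∧
      (u k ^ (1 : ℤ) • A).toSubmodule ≤ B.toSubmodule ∧ B.toSubmodule ≤ A.toSubmodule := by
    rcases hab with rfl | hab
    · obtain ⟨A, hA⟩ := exists_vertex_eq a
      refine ⟨A, A, hA, hA, ?_, le_rfl⟩
      conv_rhs => rw [← one_smul k⸨X⸩ˣ A, ← zpow_zero (u k)]
      rw [zpow_smul_le_zpow_smul_iff]
      exact zero_le_one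
    · exact exists_le_of_adj hab
  obtain ⟨i, hi⟩ := exists_dist_vertex_le_iff m a A hA (r - (1 - x.coord a))
  obtain ⟨j, hj⟩ := exists_dist_vertex_le_iff m b B hB (r - (1 - x.coord b))
  simp_rw [le_sub_iff_add_le] at hi hj
  have key : ∀ M : GrLattice k, M.detVal = m → (M.point.dist x ≤ r ↔
      (a ∈ x.coord.support ∧ M.toSubmodule ≤ (u k ^ i • A).toSubmodule) ∨
        (b ∈ x.coord.support ∧ M.toSubmodule ≤ (u k ^ j • B).toSubmodule)) := by
    intro M hM
    rw [GrLattice.point, Realization.dist_ofVertex_le_iff, ← hi M hM, ← hj M hM]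
    constructor
    · rintro ⟨c, hc, h⟩
      rcases hx hc with rfl | rfl
      · exact Or.inl ⟨hc, h⟩
      · exact Or.inr ⟨hc, h⟩
    · rintro (⟨hc, h⟩ | ⟨hc, h⟩)
      · exact ⟨a, hc, h⟩
      · exact ⟨b, hc, h⟩
  by_cases ha : a ∈ x.coord.support
  · by_cases hb : b ∈ x.coord.support
    -- The lattices `u ^ i A` and `u ^ j B` are comparable, so lying in one of them means lying in
    -- the larger.
    · rcases zpow_smul_total h1 h2 i j with h | h
      · refine ⟨u k ^ j • B, fun M hM => (key M hM).trans ⟨?_, fun h' => Or.inr ⟨hb, h'⟩⟩⟩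
        rintro (⟨-, h'⟩ | ⟨-, h'⟩)
        · exact h'.trans h
        · exact h'
      · refine ⟨u k ^ i • A, fun M hM => (key M hM).trans ⟨?_, fun h' => Or.inl ⟨ha, h'⟩⟩⟩
        rintro (⟨-, h'⟩ | ⟨-, h'⟩)
        · exact h'
        · exact h'.trans h
    · exact ⟨u k ^ i • A, fun M hM => (key M hM).trans (by simp only [ha, hb, true_and,
        false_and, or_false])⟩
  · have hb : b ∈ x.coord.support := by
      obtain ⟨c, hc⟩ := x.coord_support_nonempty
      rcases hx hc with rfl | rfl
      · exact absurd hc ha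
      · exact hc
    exact ⟨u k ^ j • B, fun M hM => (key M hM).trans (by simp only [ha, hb, true_and,
        false_and, false_or])⟩

/-- The lattices of determinant `u ^ m` contained in a given lattice. -/
def schubertSet (N : GrLattice k) (m : ℤ) : Set (GrLattice k) :=
  {M | M.detVal = m ∧ M.toSubmodule ≤ N.toSubmodule}

/-- The intersection of two lattices is again a lattice, so two inclusion conditions amount to one.
-/
lemma exists_eq_schubertSet (m : ℤ) (x₁ x₂ : Building k) (r₁ r₂ : ℝ) :
    ∃ N : GrLattice k, {M : GrLattice k |
      M.det = Submodule.span k⟦X⟧ {((u k ^ m : k⸨X⸩ˣ) : k⸨X⸩)} ∧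
      M.point.dist x₁ ≤ r₁ ∧ M.point.dist x₂ ≤ r₂} = schubertSet N m := by
  obtain ⟨L₁, h₁⟩ := exists_dist_point_le_iff m x₁ r₁
  obtain ⟨L₂, h₂⟩ := exists_dist_point_le_iff m x₂ r₂
  have := L₁.isLattice
  have := L₂.isLattice
  refine ⟨⟨L₁.toSubmodule ⊓ L₂.toSubmodule, inferInstance⟩, ?_⟩
  ext M
  rw [Set.mem_ofPred_eq, det_eq_iff]
  refine and_congr_right fun hM => ?_
  rw [h₁ M hM, h₂ M hM, ← le_inf_iff]


/-! ### Truncation and dimensions -/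

lemma natPow_smul_standardLattice (n : ℕ) :
    u k ^ n • standardLattice k = diagLattice k fun _ => (n : ℤ) := by
  rw [← zpow_smul_standardLattice, zpow_natCast]

lemma inv_natPow_smul_standardLattice (n : ℕ) :
    (u k)⁻¹ ^ n • standardLattice k = diagLattice k fun _ => -(n : ℤ) := by
  rw [← zpow_smul_standardLattice, zpow_neg, zpow_natCast, inv_pow]

/-- A lattice `L` with `uⁿ k[[u]]² ⊆ L ⊆ u⁻ⁿ k[[u]]²`. -/
structure GrLattice.IsBounded (L : GrLattice k) (n : ℕ) : Prop where
  ge : (diagLattice k fun _ => (n : ℤ)).toSubmodule ≤ L.toSubmodule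
  le : L.toSubmodule ≤ (diagLattice k fun _ => -(n : ℤ)).toSubmodule

lemma smul_eq_C_smul (t : k) (v : Fin 2 → k⸨X⸩) :
    t • v = (HahnSeries.C t : k⸨X⸩) • v := by
  ext1 a
  rw [Pi.smul_apply, Pi.smul_apply, smul_eq_mul, HahnSeries.C_mul_eq_smul]

lemma GrLattice.smul_mem (L : GrLattice k) (t : k) {v : Fin 2 → k⸨X⸩} (hv : v ∈ L.toSubmodule) :
    t • v ∈ L.toSubmodule := by
  have : t • v = (PowerSeries.C t : k⟦X⟧) • v := by
    ext1 a
    rw [smul_eq_C_smul, Pi.smul_apply, Pi.smul_apply, smul_eq_mul, Algebra.smul_def,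
      LaurentSeries.coe_algebraMap, HahnSeries.ofPowerSeries_C]
  rw [this]
  exact Submodule.smul_mem _ _ hv

/-- A lattice as a `k`-vector space. -/
def GrLattice.toSubspace (L : GrLattice k) : Submodule k (Fin 2 → k⸨X⸩) where
  __ := L.toSubmodule.toAddSubmonoid
  smul_mem' t _ hv := L.smul_mem t hv

/-- Indices for the coefficients of a vector in `u⁻ⁿ k[[u]]² / uⁿ k[[u]]²`. -/
abbrev CoeffIndex (n : ℕ) : Type := Fin 2 × Finset.Ico (-(n : ℤ)) n

/-- The coefficients of a vector in degrees between `-n` and `n`. -/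
def truncate (k : Type*) [Field k] (n : ℕ) : (Fin 2 → k⸨X⸩) →ₗ[k] (CoeffIndex n → k) where
  toFun v s := (v s.1).coeff s.2
  map_add' _ _ := rfl
  map_smul' _ _ := rfl

/-- The Laurent polynomial vector with the given coefficients. -/
def ofCoeffs (k : Type*) [Field k] (n : ℕ) : (CoeffIndex n → k) →ₗ[k] (Fin 2 → k⸨X⸩) where
  toFun c a := ∑ j : Finset.Ico (-(n : ℤ)) n, HahnSeries.single (j : ℤ) (c (a, j))
  map_add' c d := by
    ext1 a
    simp [Finset.sum_add_distrib]
  map_smul' t c := by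
    ext1 a
    rw [Pi.smul_apply, RingHom.id_apply, Finset.smul_sum]
    refine Finset.sum_congr rfl fun j _ => ?_
    ext l
    simp [HahnSeries.coeff_single]

lemma frameVector_eq {n d : ℕ} (c : FrameIndex n d → k) (i : Fin d) :
    frameVector c i = ofCoeffs k n fun s => c (i, s) := rfl

lemma coeff_ofCoeffs_of_notMem {n : ℕ} (c : CoeffIndex n → k) (a : Fin 2) {j : ℤ}
    (hj : j ∉ Finset.Ico (-(n : ℤ)) n) : (ofCoeffs k n c a).coeff j = 0 := by
  change (∑ l : Finset.Ico (-(n : ℤ)) n, HahnSeries.single (l : ℤ) (c (a, l))).coeff j = 0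
  rw [HahnSeries.coeff_sum]
  exact Finset.sum_eq_zero fun l _ =>
    HahnSeries.coeff_single_of_ne fun h => hj (h ▸ l.2)

lemma truncate_ofCoeffs {n : ℕ} (c : CoeffIndex n → k) : truncate k n (ofCoeffs k n c) = c := by
  ext ⟨a, j⟩
  change (∑ l : Finset.Ico (-(n : ℤ)) n, HahnSeries.single (l : ℤ) (c (a, l))).coeff j = _
  rw [HahnSeries.coeff_sum, Finset.sum_eq_single j]
  · exact HahnSeries.coeff_single_same _ _
  · exact fun l _ hl => HahnSeries.coeff_single_of_ne fun h => hl (Subtype.ext h.symm)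
  · simp

lemma ofCoeffs_mem {n : ℕ} (c : CoeffIndex n → k) :
    ofCoeffs k n c ∈ (diagLattice k fun _ => -(n : ℤ)).toSubmodule := by
  rw [mem_diagLattice_iff]
  exact fun a j hj => coeff_ofCoeffs_of_notMem c a (by rw [Finset.mem_Ico]; omega)

lemma truncate_eq_zero_iff {n : ℕ} {v : Fin 2 → k⸨X⸩}
    (hv : v ∈ (diagLattice k fun _ => -(n : ℤ)).toSubmodule) :
    truncate k n v = 0 ↔ v ∈ (diagLattice k fun _ => (n : ℤ)).toSubmodule := by
  rw [mem_diagLattice_iff] at hv ⊢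
  constructor
  · intro h a j hj
    rcases lt_or_ge j (-(n : ℤ)) with h' | h'
    · exact hv a j h'
    · exact congrFun h (a, ⟨j, Finset.mem_Ico.mpr ⟨h', hj⟩⟩)
  · intro h
    ext ⟨a, j, hj⟩
    exact h a j (Finset.mem_Ico.mp hj).2

lemma sub_ofCoeffs_truncate_mem {n : ℕ} {v : Fin 2 → k⸨X⸩}
    (hv : v ∈ (diagLattice k fun _ => -(n : ℤ)).toSubmodule) :
    v - ofCoeffs k n (truncate k n v) ∈ (diagLattice k fun _ => (n : ℤ)).toSubmodule := by
  rw [← truncate_eq_zero_iff (Submodule.sub_mem _ hv (ofCoeffs_mem _)), map_sub,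
    truncate_ofCoeffs, sub_self]

lemma GrLattice.IsBounded.ofCoeffs_truncate_mem {L : GrLattice k} {n : ℕ} (hL : L.IsBounded n)
    {v : Fin 2 → k⸨X⸩} (hv : v ∈ L.toSubmodule) :
    ofCoeffs k n (truncate k n v) ∈ L.toSubmodule := by
  have := Submodule.sub_mem _ hv (hL.ge (sub_ofCoeffs_truncate_mem (hL.le hv)))
  rwa [sub_sub_cancel] at this

/-- The coefficients of `g⁻¹ v` in degrees from `e` to `n`. -/
def divisorCoeffs (g : GL (Fin 2) k⸨X⸩) (e : Fin 2 → ℤ) (n : ℕ) :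
    (Fin 2 → k⸨X⸩) →ₗ[k] ((Σ a : Fin 2, Finset.Ico (e a) (n : ℤ)) → k) where
  toFun v s := ((g⁻¹).1.mulVec v s.1).coeff s.2
  map_add' v w := by
    ext s
    rw [Matrix.mulVec_add]
    rfl
  map_smul' t v := by
    ext s
    rw [smul_eq_C_smul, Matrix.mulVec_smul, ← smul_eq_C_smul]
    rfl

lemma divisorCoeffs_surjective (g : GL (Fin 2) k⸨X⸩) (e : Fin 2 → ℤ) (n : ℕ)
    (c : (Σ a : Fin 2, Finset.Ico (e a) (n : ℤ)) → k) :
    ∃ v ∈ (g • diagLattice k e).toSubmodule, divisorCoeffs g e n v = c := by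
  refine ⟨g.1.mulVec fun a => ∑ j : Finset.Ico (e a) (n : ℤ),
    HahnSeries.single (j : ℤ) (c ⟨a, j⟩), ?_, ?_⟩
  · rw [mulVec_mem_glSmul_iff, mem_diagLattice_iff]
    intro a j hj
    rw [HahnSeries.coeff_sum]
    refine Finset.sum_eq_zero fun l _ => HahnSeries.coeff_single_of_ne fun h => ?_
    have := Finset.mem_Ico.mp l.2
    omega
  · ext ⟨a, j⟩
    change ((g⁻¹).1.mulVec (g.1.mulVec _) a).coeff j = _
    rw [Matrix.mulVec_mulVec, ← Units.val_mul, inv_mul_cancel, Units.val_one,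
      Matrix.one_mulVec, HahnSeries.coeff_sum, Finset.sum_eq_single j]
    · exact HahnSeries.coeff_single_same _ _
    · exact fun l _ hl => HahnSeries.coeff_single_of_ne fun h => hl (Subtype.ext h.symm)
    · simp

lemma divisorCoeffs_eq_zero_iff {g : GL (Fin 2) k⸨X⸩} {e : Fin 2 → ℤ} {n : ℕ}
    {v : Fin 2 → k⸨X⸩} (hv : v ∈ (g • diagLattice k e).toSubmodule) :
    divisorCoeffs g e n v = 0 ↔ v ∈ (g • diagLattice k fun _ => (n : ℤ)).toSubmodule := by
  rw [mem_glSmul_iff, mem_diagLattice_iff] at hv ⊢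
  constructor
  · intro h a j hj
    rcases lt_or_ge j (e a) with h' | h'
    · exact hv a j h'
    · exact congrFun h ⟨a, ⟨j, Finset.mem_Ico.mpr ⟨h', hj⟩⟩⟩
  · intro h
    ext ⟨a, j, hj⟩
    exact h a j (Finset.mem_Ico.mp hj).2

/-- The image of a lattice `L` in `u⁻ⁿ k[[u]]² / uⁿ k[[u]]²`. -/
def GrLattice.truncated (L : GrLattice k) (n : ℕ) : Submodule k (CoeffIndex n → k) :=
  L.toSubspace.map (truncate k n)

/-- In a basis of `k[[u]]²` adapted to `L`, the quotient of `L` by `uⁿ k[[u]]²` has dimension `(n -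
e 0) + (n - e 1)`. -/
lemma finrank_truncated {L : GrLattice k} {n : ℕ} (hL : L.IsBounded n) :
    (Module.finrank k (L.truncated n) : ℤ) = 2 * n - L.detVal := by
  obtain ⟨g, e, -, hs, rfl⟩ := exists_adapted L (standardLattice k)
  have hn : g • (diagLattice k fun _ => (n : ℤ)) = diagLattice k fun _ => (n : ℤ) := by
    rw [← zpow_smul_standardLattice, gl_unit_smul_comm, ← hs]
  have he : ∀ a, e a ≤ n := by
    have := hL.ge
    rwa [← hn, glSmul_le_iff, diagLattice_le_iff] at this
  rw [GrLattice.truncated, ← LinearMap.range_domRestrict]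
  have hS : Function.Surjective
      ((divisorCoeffs g e n).domRestrict (g • diagLattice k e).toSubspace) := by
    intro c
    obtain ⟨v, hv, h⟩ := divisorCoeffs_surjective g e n c
    exact ⟨⟨v, hv⟩, h⟩
  -- On `L` both coefficient maps vanish exactly on `uⁿ k[[u]]²`, because `g` preserves that
  -- lattice; so their images have equal dimension.
  have hker : LinearMap.ker ((truncate k n).domRestrict (g • diagLattice k e).toSubspace) =
      LinearMap.ker ((divisorCoeffs g e n).domRestrict (g • diagLattice k e).toSubspace) := by
    ext ⟨v, hv⟩
    rw [LinearMap.mem_ker, LinearMap.mem_ker, LinearMap.domRestrict_apply,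
      LinearMap.domRestrict_apply, divisorCoeffs_eq_zero_iff hv, hn]
    exact truncate_eq_zero_iff (hL.le hv)
  rw [← (LinearMap.quotKerEquivRange _).finrank_eq, hker,
    (LinearMap.quotKerEquivOfSurjective _ hS).finrank_eq, Module.finrank_fintype_fun_eq_card,
    Fintype.card_sigma, Fin.sum_univ_two, Fintype.card_coe, Fintype.card_coe, Int.card_Ico,
    Int.card_Ico, detVal_glSmul_diagLattice, ← hs, detVal_standardLattice]
  have h0 := he 0
  have h1 := he 1
  omega

/-! ### Frames -/

lemma linearIndependent_frameVector_iff {n d : ℕ} (c : FrameIndex n d → k) :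
    LinearIndependent k (frameVector c) ↔ LinearIndependent k fun i s => c (i, s) := by
  have hinj : LinearMap.ker (ofCoeffs k n) = ⊥ :=
    LinearMap.ker_eq_bot.mpr (Function.LeftInverse.injective truncate_ofCoeffs)
  have h : frameVector c = ofCoeffs k n ∘ fun i s => c (i, s) := rfl
  rw [h, LinearMap.linearIndependent_iff _ hinj]

lemma Frame.isBounded {n d : ℕ} (F : Frame k n d) : F.lattice.IsBounded n where
  ge v hv := by
    rw [F.mem_iff]
    exact ⟨0, by simpa [natPow_smul_standardLattice] using hv⟩
  le v hv := by
    obtain ⟨t, ht⟩ := (F.mem_iff v).mp hv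
    rw [natPow_smul_standardLattice] at ht
    have h1 : (diagLattice k fun _ => (n : ℤ)).toSubmodule ≤
        (diagLattice k fun _ => -(n : ℤ)).toSubmodule := by
      rw [diagLattice_le_iff]
      intro _
      change -(n : ℤ) ≤ n
      omega
    have h2 : ∑ i, t i • frameVector F.coeffs i ∈
        (diagLattice k fun _ => -(n : ℤ)).toSubmodule :=
      Submodule.sum_mem _ fun i _ => by
        rw [frameVector_eq]
        exact GrLattice.smul_mem _ _ (ofCoeffs_mem _)
    simpa using Submodule.add_mem _ (h1 ht) h2

lemma Frame.frameVector_mem {n d : ℕ} (F : Frame k n d) (i : Fin d) :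
    frameVector F.coeffs i ∈ F.lattice.toSubmodule := by
  rw [F.mem_iff]
  exact ⟨Pi.single i 1, by simp [Pi.single_apply, ite_smul]⟩

/-- A frame is a basis of the truncated lattice. Consequently the determinant is constant on each
`Frame k n d`, and fixing it imposes no further equations there. -/
lemma Frame.detVal_eq {n d : ℕ} (F : Frame k n d) : F.lattice.detVal = 2 * n - d := by
  have hspan : F.lattice.truncated n =
      Submodule.span k (Set.range fun i s => F.coeffs (i, s)) := by
    apply le_antisymm
    · rintro _ ⟨v, hv, rfl⟩
      obtain ⟨t, ht⟩ := (F.mem_iff v).mp hv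
      rw [natPow_smul_standardLattice] at ht
      have h0 := (truncate_eq_zero_iff (F.isBounded.le (F.isBounded.ge ht))).mpr ht
      rw [map_sub, sub_eq_zero, map_sum] at h0
      rw [h0]
      refine Submodule.sum_mem _ fun i _ => ?_
      rw [map_smul, frameVector_eq, truncate_ofCoeffs]
      exact Submodule.smul_mem _ _ (Submodule.subset_span ⟨i, rfl⟩)
    · rw [Submodule.span_le]
      rintro _ ⟨i, rfl⟩
      exact ⟨_, F.frameVector_mem i, by rw [frameVector_eq, truncate_ofCoeffs]⟩
  have h := finrank_truncated F.isBounded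
  rw [hspan, finrank_span_eq_card
    ((linearIndependent_frameVector_iff _).mp F.linearIndependent), Fintype.card_fin] at h
  omega

/-- The determinant gives the truncated lattice dimension `d`, so `d` independent vectors in it
already span. -/
lemma GrLattice.IsBounded.exists_frame_of_linearIndependent {L : GrLattice k} {n d : ℕ}
    (hL : L.IsBounded n) (hd : L.detVal = 2 * n - d) (c : FrameIndex n d → k)
    (hc : LinearIndependent k fun i s => c (i, s))
    (hmem : ∀ i, frameVector c i ∈ L.toSubmodule) :
    ∃ F : Frame k n d, F.coeffs = c ∧ F.lattice = L := by
  refine ⟨⟨c, L, (linearIndependent_frameVector_iff c).mpr hc, fun v => ?_⟩, rfl, rfl⟩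
  rw [natPow_smul_standardLattice]
  have hsum : ∀ t : Fin d → k, ∑ i, t i • frameVector c i ∈ L.toSubmodule := fun t =>
    Submodule.sum_mem _ fun i _ => L.smul_mem _ (hmem i)
  constructor
  · intro hv
    have hle : Submodule.span k (Set.range fun i s => c (i, s)) ≤
        L.truncated n := by
      rw [Submodule.span_le]
      rintro _ ⟨i, rfl⟩
      exact ⟨_, hmem i, by rw [frameVector_eq, truncate_ofCoeffs]⟩
    have heq := Submodule.eq_of_le_of_finrank_eq hle (by
      have h : (Module.finrank k (L.truncated n) : ℤ) = d := by
        rw [finrank_truncated hL, hd]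
        ring
      rw [finrank_span_eq_card hc, Fintype.card_fin]
      exact (Int.ofNat_inj.mp h).symm)
    have hv' : truncate k n v ∈ L.truncated n := ⟨v, hv, rfl⟩
    rw [← heq, Submodule.mem_span_range_iff_exists_fun] at hv'
    obtain ⟨t, ht⟩ := hv'
    refine ⟨t, ?_⟩
    rw [← truncate_eq_zero_iff (hL.le (Submodule.sub_mem _ hv (hsum t))), map_sub, ← ht, map_sum,
      sub_eq_zero]
    refine Finset.sum_congr rfl fun i _ => ?_
    rw [map_smul, frameVector_eq, truncate_ofCoeffs]
  · rintro ⟨t, ht⟩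
    simpa using Submodule.add_mem _ (hL.ge ht) (hsum t)

lemma GrLattice.IsBounded.exists_frame {L : GrLattice k} {n : ℕ} (hL : L.IsBounded n) :
    ∃ (d : ℕ) (F : Frame k n d), F.lattice = L := by
  let b := Module.finBasis k (L.truncated n)
  obtain ⟨F, -, hF⟩ := hL.exists_frame_of_linearIndependent
    (d := Module.finrank k (L.truncated n))
    (by rw [finrank_truncated hL]; omega) (fun s => (b s.1).1 s.2)
    (b.linearIndependent.map' (Submodule.subtype _) (Submodule.ker_subtype _)) (fun i => by
      obtain ⟨v, hv, h⟩ := (b i).2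
      rw [frameVector_eq]
      change ofCoeffs k n (b i).1 ∈ _
      rw [← h]
      exact hL.ofCoeffs_truncate_mem hv)
  exact ⟨_, F, hF⟩

/-! ### The Zariski topology -/

lemma isClosed_zariski_setOf_eval_eq_zero {σ : Type*} (f : MvPolynomial σ k) :
    @IsClosed _ (zariskiTopology σ k) {c | MvPolynomial.eval c f = 0} := by
  rw [isClosed_induced_iff]
  refine ⟨PrimeSpectrum.zeroLocus {f}, PrimeSpectrum.isClosed_zeroLocus _, ?_⟩
  ext c
  rw [Set.mem_preimage, PrimeSpectrum.mem_zeroLocus, Set.singleton_subset_iff]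
  exact MvPolynomial.mem_vanishingIdeal_singleton_iff c f

lemma exists_eval_ne_zero_of_isOpen_zariski {σ : Type*} {W : Set (σ → k)}
    (hW : @IsOpen _ (zariskiTopology σ k) W) {c : σ → k} (hc : c ∈ W) :
    ∃ f : MvPolynomial σ k, MvPolynomial.eval c f ≠ 0 ∧
      ∀ d, MvPolynomial.eval d f ≠ 0 → d ∈ W := by
  obtain ⟨V, hV, rfl⟩ := isOpen_induced_iff.mp hW
  obtain ⟨_, ⟨f, rfl⟩, hcf, hfV⟩ :=
    PrimeSpectrum.isTopologicalBasis_basic_opens.exists_subset_of_mem_open hc hV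
  have key : ∀ d : σ → k, MvPolynomial.pointToPoint d ∈
      (PrimeSpectrum.basicOpen f : Set (PrimeSpectrum (MvPolynomial σ k))) ↔
        MvPolynomial.eval d f ≠ 0 := by
    intro d
    exact (MvPolynomial.mem_vanishingIdeal_singleton_iff d f).not
  exact ⟨f, (key c).mp hcf, fun d hd => hfV ((key d).mpr hd)⟩

/-- Restricted to the line, `f` is a polynomial in `t` that does not vanish at `t = 0`. -/
lemma finite_setOf_eval_line_eq_zero {σ : Type*} (f : MvPolynomial σ k) (c d : σ → k)
    (hc : MvPolynomial.eval c f ≠ 0) :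
    {t : k | MvPolynomial.eval (c + t • d) f = 0}.Finite := by
  let q : Polynomial k := MvPolynomial.aeval
    (fun s => Polynomial.C (c s) + Polynomial.X * Polynomial.C (d s)) f
  have hq : ∀ t, q.eval t = MvPolynomial.eval (c + t • d) f := by
    intro t
    change Polynomial.evalRingHom t (MvPolynomial.aeval _ f) = _
    rw [MvPolynomial.aeval_def, MvPolynomial.hom_eval₂, MvPolynomial.eval, MvPolynomial.coe_eval₂Hom]
    congr 1
    · ext; simp
    · ext s; simp; ring
  have hq0 : q ≠ 0 := by
    intro h
    apply hc
    have := hq 0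
    rw [h, Polynomial.eval_zero, zero_smul, add_zero] at this
    exact this.symm
  refine (Polynomial.finite_setOfPred_isRoot hq0).subset fun t ht => ?_
  change q.eval t = 0
  rw [hq]
  exact ht

/-- Independence is an open condition: if `l` is a linear left inverse of the linear combination map
of `c`, the determinant of the rows `l (c' i)` is a polynomial in `c'` with value `1` at `c`, and it
vanishes on dependent families. -/
lemma exists_eval_ne_zero_of_linearIndependent {n d : ℕ} {c : FrameIndex n d → k}
    (hc : LinearIndependent k fun i s => c (i, s)) :
    ∃ f : MvPolynomial (FrameIndex n d) k, MvPolynomial.eval c f ≠ 0 ∧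
      ∀ c', MvPolynomial.eval c' f ≠ 0 → LinearIndependent k fun i s => c' (i, s) := by
  obtain ⟨l, hl⟩ := LinearMap.exists_leftInverse_of_injective
    (Fintype.linearCombination k fun i s => c (i, s))
    (LinearMap.ker_eq_bot.mpr hc.fintypeLinearCombination_injective)
  let A : Matrix (Fin d) (Fin d) (MvPolynomial (FrameIndex n d) k) :=
    Matrix.of fun i j => ∑ s, MvPolynomial.C (l (Pi.single s 1) j) * MvPolynomial.X (i, s)
  have hA : ∀ c', MvPolynomial.eval c' A.det =
      Matrix.det (Matrix.of fun i => l fun s => c' (i, s)) := by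
    intro c'
    rw [RingHom.map_det]
    congr 1
    ext i j
    have : (fun s => c' (i, s)) = ∑ s, c' (i, s) • Pi.single s (1 : k) := by
      ext s
      simp [Finset.sum_apply, Pi.single_apply]
    rw [Matrix.of_apply, this, map_sum, Finset.sum_apply]
    simp [A, mul_comm]
  refine ⟨A.det, ?_, fun c' hc' => ?_⟩
  · rw [hA]
    have : (Matrix.of fun i => l fun s => c (i, s)) = (1 : Matrix (Fin d) (Fin d) k) := by
      ext i j
      have := LinearMap.congr_fun hl (Pi.single i 1)
      rw [LinearMap.comp_apply, Fintype.linearCombination_apply_single, one_smul,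
        LinearMap.id_apply] at this
      rw [Matrix.of_apply, this, Matrix.one_apply, Pi.single_apply]
      simp only [eq_comm]
    rw [this, Matrix.det_one]
    exact one_ne_zero
  · rw [hA] at hc'
    exact LinearIndependent.of_comp l (Matrix.linearIndependent_rows_of_det_ne_zero hc')

lemma isOpen_iff_frame {U : Set (GrLattice k)} :
    IsOpen U ↔ ∀ n d : ℕ, IsOpen ((Frame.lattice : Frame k n d → GrLattice k) ⁻¹' U) := by
  simp only [isOpen_iSup_iff, isOpen_coinduced]

lemma isClosed_iff_frame {Z : Set (GrLattice k)} :
    IsClosed Z ↔ ∀ n d : ℕ, IsClosed ((Frame.lattice : Frame k n d → GrLattice k) ⁻¹' Z) := by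
  simp only [isClosed_iSup_iff, isClosed_coinduced]

/-- A linear family of lattices lies in an open neighbourhood of one of its members for all but
finitely many parameters. -/
lemma finite_setOf_line_notMem {M : GrLattice k} {n : ℕ} (hM : M.IsBounded n)
    {U : Set (GrLattice k)} (hU : IsOpen U) (hMU : M ∈ U)
    (B : Matrix (Fin 2) (Fin 2) k⸨X⸩) :
    {t : k | ∃ L : GrLattice k, L ∉ U ∧ L.detVal = M.detVal ∧ L.IsBounded n ∧
      ∀ v ∈ M.toSubmodule, v + t • B.mulVec v ∈ L.toSubmodule}.Finite := by
  obtain ⟨d, F, rfl⟩ := hM.exists_frame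
  obtain ⟨W, hW, hWU⟩ := (@isOpen_induced_iff _ _ (zariskiTopology _ k) _ _).mp (isOpen_iff_frame.mp hU n d)
  have hc : F.coeffs ∈ W := by
    change F ∈ Frame.coeffs ⁻¹' W
    rw [hWU]
    exact hMU
  obtain ⟨f₁, hf₁, h₁⟩ := exists_eval_ne_zero_of_isOpen_zariski hW hc
  obtain ⟨f₂, hf₂, h₂⟩ := exists_eval_ne_zero_of_linearIndependent
    ((linearIndependent_frameVector_iff _).mp F.linearIndependent)
  -- Applying `1 + t B` to the frame vectors and truncating moves the coefficients along the line
  -- with direction `c'`.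
  let c' : FrameIndex n d → k := fun s =>
    truncate k n (B.mulVec (frameVector F.coeffs s.1)) s.2
  refine ((finite_setOf_eval_line_eq_zero f₁ F.coeffs c' hf₁).union
    (finite_setOf_eval_line_eq_zero f₂ F.coeffs c' hf₂)).subset ?_
  rintro t ⟨L, hLU, hdet, hL, hv⟩
  by_contra! hbad
  rw [Set.mem_union, not_or] at hbad
  have hrow : ∀ i, frameVector (F.coeffs + t • c') i =
      ofCoeffs k n (truncate k n (frameVector F.coeffs i + t • B.mulVec (frameVector F.coeffs i))) := by
    intro i
    rw [frameVector_eq, map_add, map_smul, frameVector_eq, truncate_ofCoeffs]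
    rfl
  -- The moved vectors lie in `L` and are independent, so they form a frame of `L`; thus `1 + t B`
  -- itself need not be invertible.
  obtain ⟨F', hF', rfl⟩ := hL.exists_frame_of_linearIndependent (hdet.trans F.detVal_eq)
    (F.coeffs + t • c') (h₂ _ hbad.2) (fun i => by
      rw [hrow]
      exact hL.ofCoeffs_truncate_mem (hv _ (F.frameVector_mem i)))
  apply hLU
  have : F' ∈ Frame.coeffs ⁻¹' W := by
    rw [Set.mem_preimage, hF']
    exact h₁ _ hbad.1
  rwa [hWU] at this

/-- On frames, `L ⊆ N` says that `uⁿ k[[u]]²` and all frame vectors lie in `N`. The former does not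
depend on the frame, and the latter is given by linear equations in its coefficients. -/
lemma isClosed_schubertSet (N : GrLattice k) (m : ℤ) : IsClosed (schubertSet N m) := by
  rw [isClosed_iff_frame]
  intro n d
  by_cases h : (2 * n - d : ℤ) = m ∧ (diagLattice k fun _ => (n : ℤ)).toSubmodule ≤ N.toSubmodule
  swap
  · convert! isClosed_empty
    rw [Set.eq_empty_iff_forall_notMem]
    rintro F ⟨hdet, hle⟩
    exact h ⟨F.detVal_eq.symm.trans hdet, F.isBounded.ge.trans hle⟩
  · let W : Submodule k (CoeffIndex n → k) := N.toSubspace.comap (ofCoeffs k n)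
    let P (i : Fin d) (φ : Module.Dual k (CoeffIndex n → k)) : MvPolynomial (FrameIndex n d) k :=
      ∑ s, MvPolynomial.C (φ (Pi.single s 1)) * MvPolynomial.X (i, s)
    have hP : ∀ i φ c, MvPolynomial.eval c (P i φ) = φ fun s => c (i, s) := by
      intro i φ c
      have : (fun s => c (i, s)) = ∑ s, c (i, s) • Pi.single s (1 : k) := by
        ext s
        simp [Finset.sum_apply, Pi.single_apply]
      rw [this, map_sum]
      simp [mul_comm]
    -- The equations come from the functionals that annihilate `W`, which cut out `W` exactly.
    have heq : (Frame.lattice : Frame k n d → GrLattice k) ⁻¹' schubertSet N m =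
        ⋂ (i : Fin d), ⋂ φ ∈ W.dualAnnihilator,
          Frame.coeffs ⁻¹' {c | MvPolynomial.eval c (P i φ) = 0} := by
      ext F
      simp only [Set.mem_iInter, Set.mem_preimage, Set.mem_ofPred_eq, hP]
      have hW : ∀ i, (∀ φ ∈ W.dualAnnihilator, φ (fun s => F.coeffs (i, s)) = 0) ↔
          frameVector F.coeffs i ∈ N.toSubmodule := fun i =>
        Subspace.forall_mem_dualAnnihilator_apply_eq_zero_iff W _
      simp_rw [hW]
      constructor
      · exact fun hF i => hF.2 (F.frameVector_mem i)
      · refine fun hF => ⟨F.detVal_eq.trans h.1, fun v hv => ?_⟩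
        obtain ⟨t, ht⟩ := (F.mem_iff v).mp hv
        rw [natPow_smul_standardLattice] at ht
        simpa using Submodule.add_mem _ (h.2 ht)
          (Submodule.sum_mem _ fun i (_ : i ∈ Finset.univ) => N.smul_mem (t i) (hF i))
    rw [heq]
    exact isClosed_iInter fun i => isClosed_biInter fun φ _ =>
      (@isClosed_induced_iff _ _ (zariskiTopology _ k) _ _).mpr ⟨_, isClosed_zariski_setOf_eval_eq_zero _, rfl⟩


/-! ### Schubert varieties -/

/-- Both exponents of `L` relative to `N` are nonnegative with sum `m - N.detVal`, so neither
exceeds that sum. -/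
lemma zpow_smul_le_of_mem_schubertSet {N L : GrLattice k} {m : ℤ} (hL : L ∈ schubertSet N m) :
    (u k ^ (m - N.detVal) • N).toSubmodule ≤ L.toSubmodule := by
  obtain ⟨rfl, hle⟩ := hL
  obtain ⟨g, e, -, rfl, rfl⟩ := exists_adapted L N
  rw [← diagLattice_zero, glSmul_le_iff, diagLattice_le_iff] at hle
  rw [← gl_unit_smul_comm, glSmul_le_iff, zpow_smul_standardLattice, diagLattice_le_iff,
    detVal_glSmul_diagLattice, Pi.le_def, Fin.forall_fin_two]
  have h0 : 0 ≤ e 0 := hle 0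
  have h1 : 0 ≤ e 1 := hle 1
  omega

lemma exists_isBounded (N : GrLattice k) (m : ℤ) :
    ∃ n : ℕ, ∀ L ∈ schubertSet N m, L.IsBounded n := by
  obtain ⟨a, ha⟩ := exists_le_zpow_smul N (standardLattice k)
  obtain ⟨b, hb⟩ := exists_le_zpow_smul (standardLattice k) (u k ^ (m - N.detVal) • N)
  refine ⟨max a b, fun L hL => ⟨?_, ?_⟩⟩
  · refine le_trans ?_ (zpow_smul_le_of_mem_schubertSet hL)
    rw [← zpow_smul_standardLattice, ← unitSmul_le_iff (u k ^ (-((max a b : ℕ) : ℤ))), smul_smul,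
      ← zpow_add, neg_add_cancel, zpow_zero, one_smul]
    exact hb _ (le_max_right _ _)
  · refine hL.2.trans ?_
    rw [← zpow_smul_standardLattice]
    exact ha _ (le_max_left _ _)

lemma isClosedSubvariety_schubertSet (N : GrLattice k) (m : ℤ) :
    IsClosedSubvariety (schubertSet N m) := by
  obtain ⟨n, hn⟩ := exists_isBounded N m
  refine ⟨isClosed_schubertSet N m, n, fun L hL => ?_⟩
  rw [natPow_smul_standardLattice, inv_natPow_smul_standardLattice]
  exact ⟨(hn L hL).ge, (hn L hL).le⟩

/-- The determinant of `h` shifts all valuations by the same amount, which is `0` because `h` fixes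
`N`. -/
lemma glSmul_mem_schubertSet {N M : GrLattice k} {m : ℤ} {h : GL (Fin 2) k⸨X⸩}
    (hN : h • N = N) (hM : M ∈ schubertSet N m) : h • M ∈ schubertSet N m := by
  obtain ⟨c, hc⟩ := exists_detVal_glSmul h
  have h0 := hc N
  rw [hN] at h0
  refine ⟨?_, ?_⟩
  · rw [hc, hM.1]
    omega
  · rw [← hN, glSmul_le_iff]
    exact hM.2

/-- The lattice spanned by `u ^ (m - v) * x` and `y`, where `x, y` is the basis of `g k[[u]]²` given
by `g` and `u ^ v` generates the determinant of that lattice. -/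
def schubertGenerator (g : GL (Fin 2) k⸨X⸩) (m : ℤ) : GrLattice k :=
  g • diagLattice k ![m - (g • standardLattice k).detVal, 0]

lemma mem_orbit_latticeGL_iff {N M L : GrLattice k} :
    L ∈ MulAction.orbit (latticeGL N) M ↔ ∃ h : GL (Fin 2) k⸨X⸩, h • N = N ∧ L = h • M := by
  constructor
  · rintro ⟨h, rfl⟩
    exact ⟨h.1, h.2, rfl⟩
  · rintro ⟨h, hN, rfl⟩
    exact ⟨⟨h, hN⟩, rfl⟩

/-- Not lying in `u N` forces the smaller exponent to be `0`, and the determinant then fixes the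
other. The change between the two bases of `N` stabilizes `N`. -/
lemma mem_orbit_of_not_le {g : GL (Fin 2) k⸨X⸩} {m : ℤ} {M : GrLattice k}
    (hM : M ∈ schubertSet (g • standardLattice k) m)
    (h : ¬ M.toSubmodule ≤ (u k ^ (1 : ℤ) • g • standardLattice k).toSubmodule) :
    M ∈ MulAction.orbit (latticeGL (g • standardLattice k)) (schubertGenerator g m) := by
  obtain ⟨g', e, he, hN, rfl⟩ := exists_adapted M (g • standardLattice k)
  obtain ⟨hdet, hle⟩ := hM
  rw [hN, ← diagLattice_zero, glSmul_le_iff, diagLattice_le_iff] at hle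
  rw [hN, ← gl_unit_smul_comm, glSmul_le_iff, zpow_smul_standardLattice, diagLattice_le_iff,
    Pi.le_def, Fin.forall_fin_two] at h
  rw [detVal_glSmul_diagLattice, ← hN] at hdet
  have h1 : 0 ≤ e 1 := hle 1
  refine mem_orbit_latticeGL_iff.mpr ⟨g' * g⁻¹, ?_, ?_⟩
  · rw [mul_smul, inv_smul_smul, ← hN]
  · rw [schubertGenerator, mul_smul, inv_smul_smul]
    congr 2
    ext a
    fin_cases a
    · change e 0 = m - _
      omega
    · change e 1 = 0
      omega

lemma schubertGenerator_mem {g : GL (Fin 2) k⸨X⸩} {m : ℤ}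
    (h : (g • standardLattice k).detVal ≤ m) :
    schubertGenerator g m ∈ schubertSet (g • standardLattice k) m := by
  refine ⟨?_, ?_⟩
  · rw [schubertGenerator, detVal_glSmul_diagLattice]
    simp
  · rw [schubertGenerator, ← diagLattice_zero, glSmul_le_iff, diagLattice_le_iff, diagLattice_zero,
      Pi.le_def, Fin.forall_fin_two]
    simpa using h

lemma orbit_subset_schubertSet {N M : GrLattice k} {m : ℤ} (hM : M ∈ schubertSet N m) :
    MulAction.orbit (latticeGL N) M ⊆ schubertSet N m := by
  intro L hL
  obtain ⟨h, hN, rfl⟩ := mem_orbit_latticeGL_iff.mp hL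
  exact glSmul_mem_schubertSet hN hM

/-- The unipotent matrix with upper right entry `t * u ^ (-f)`. -/
def unipotent (f : ℤ) (t : k) : GL (Fin 2) k⸨X⸩ :=
  Matrix.GeneralLinearGroup.mkOfDetNeZero
    !![1, HahnSeries.C t * (u k ^ (-f) : k⸨X⸩ˣ).1; 0, 1] (by simp)

lemma unipotent_mulVec (f : ℤ) (t : k) (v : Fin 2 → k⸨X⸩) :
    (unipotent f t).1.mulVec v = ![v 0 + t • ((u k ^ (-f) : k⸨X⸩ˣ).1 * v 1), v 1] := by
  change Matrix.mulVec !![1, HahnSeries.C t * (u k ^ (-f) : k⸨X⸩ˣ).1; 0, 1] v = _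
  ext1 a
  fin_cases a
  · have : HahnSeries.C t * (u k ^ (-f) : k⸨X⸩ˣ).1 * v 1 =
        t • ((u k ^ (-f) : k⸨X⸩ˣ).1 * v 1) := by
      rw [mul_assoc, HahnSeries.C_mul_eq_smul]
    simpa [Matrix.mulVec, dotProduct, Fin.sum_univ_two] using this
  · simp [Matrix.mulVec, dotProduct, Fin.sum_univ_two]

/-- The matrix has determinant `1`, and its pole of order `e 1` is absorbed by second coordinates
divisible by `u ^ e 1`. -/
lemma unipotent_smul_diagLattice_mem (g : GL (Fin 2) k⸨X⸩) {e : Fin 2 → ℤ} {m : ℤ}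
    (he : g • diagLattice k e ∈ schubertSet (g • standardLattice k) m) (t : k) :
    g • unipotent (e 1) t • diagLattice k e ∈ schubertSet (g • standardLattice k) m := by
  obtain ⟨hdet, hle⟩ := he
  obtain ⟨c, hc⟩ := exists_detVal_glSmul g
  rw [← diagLattice_zero, glSmul_le_iff, diagLattice_le_iff] at hle
  refine ⟨?_, ?_⟩
  · rw [hc] at hdet ⊢
    rw [← hdet, add_left_inj, detVal_eq_iff, det_glSmul_of_det_eq _ (det_diagLattice e),
      det_diagLattice]
    change Submodule.span _ {Matrix.det !![1, _; 0, 1] * _} = _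
    rw [Matrix.det_fin_two_of, mul_one, mul_zero, sub_zero, one_mul]
  · rw [glSmul_le_iff]
    rintro _ ⟨v, hv, rfl⟩
    rw [SetLike.mem_coe, mem_diagLattice_iff] at hv
    rw [glMap_apply, unipotent_mulVec, mem_standardLattice_iff, Fin.forall_fin_two]
    have h0 : 0 ≤ e 0 := hle 0
    have h1 : 0 ≤ e 1 := hle 1
    refine ⟨fun i hi => ?_, fun i hi => hv 1 i (by omega)⟩
    change (v 0 + t • ((u k ^ (-e 1) : k⸨X⸩ˣ).1 * v 1)).coeff i = 0
    rw [HahnSeries.coeff_add, HahnSeries.coeff_smul, coeff_u_zpow_mul, hv 0 i (by omega),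
      hv 1 _ (by omega), smul_zero, add_zero]

/-- The image of `(0, u ^ e 1)` is `(t, u ^ e 1)`, whose first coordinate is a nonzero constant. -/
lemma unipotent_smul_diagLattice_not_le (g : GL (Fin 2) k⸨X⸩) (e : Fin 2 → ℤ) {t : k}
    (ht : t ≠ 0) : ¬ (g • unipotent (e 1) t • diagLattice k e).toSubmodule ≤
      (u k ^ (1 : ℤ) • g • standardLattice k).toSubmodule := by
  rw [← gl_unit_smul_comm, glSmul_le_iff, zpow_smul_standardLattice]
  intro h
  have hv : ![0, (u k ^ e 1 : k⸨X⸩ˣ).1] ∈ (diagLattice k e).toSubmodule := by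
    rw [mem_diagLattice_iff, Fin.forall_fin_two]
    refine ⟨fun i _ => HahnSeries.coeff_zero, fun i hi => ?_⟩
    change (u k ^ e 1 : k⸨X⸩ˣ).1.coeff i = 0
    rw [u_zpow_coe, HahnSeries.coeff_single_of_ne hi.ne]
  have h2 := h ((mulVec_mem_glSmul_iff (unipotent (e 1) t) _ _).mpr hv)
  rw [mem_diagLattice_iff, unipotent_mulVec] at h2
  have h3 := h2 0 0 zero_lt_one
  simp only [Matrix.cons_val_zero, Matrix.cons_val_one] at h3
  rw [zero_add, ← Units.val_mul, ← zpow_add, neg_add_cancel, u_zpow_coe, HahnSeries.coeff_smul,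
    HahnSeries.coeff_single_same, smul_eq_mul, mul_one] at h3
  exact ht h3

lemma schubertSet_subset_closure [Infinite k] (g : GL (Fin 2) k⸨X⸩) (m : ℤ) :
    schubertSet (g • standardLattice k) m ⊆ closure
      (MulAction.orbit (latticeGL (g • standardLattice k)) (schubertGenerator g m)) := by
  intro M hM
  rw [mem_closure_iff]
  intro U hU hMU
  obtain ⟨n, hn⟩ := exists_isBounded (g • standardLattice k) m
  obtain ⟨g', e, -, hN, rfl⟩ := exists_adapted M (g • standardLattice k)
  -- Chosen so that `1 + t B` is the conjugate by `g'` of `unipotent (e 1) t`.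
  let B : Matrix (Fin 2) (Fin 2) k⸨X⸩ := g'.1 * ((unipotent (e 1) 1).1 - 1) * (g'⁻¹).1
  have hB : ∀ (t : k) (v : Fin 2 → k⸨X⸩), g'.1.mulVec v + t • B.mulVec (g'.1.mulVec v) =
      g'.1.mulVec ((unipotent (e 1) t).1.mulVec v) := by
    intro t v
    rw [Matrix.mulVec_mulVec, Matrix.mul_assoc, ← Units.val_mul, inv_mul_cancel, Units.val_one,
      Matrix.mul_one, ← Matrix.mulVec_mulVec, smul_eq_C_smul, ← Matrix.mulVec_smul,
      ← Matrix.mulVec_add]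
    congr 1
    rw [Matrix.sub_mulVec, Matrix.one_mulVec, ← smul_eq_C_smul, unipotent_mulVec,
      unipotent_mulVec]
    ext1 a
    fin_cases a <;> simp [Matrix.vecHead, Matrix.vecTail]
  -- A nonzero `t` for which the moved lattice is still in `U`.
  obtain ⟨t, ht⟩ := ((finite_setOf_line_notMem (hn _ hM) hU hMU B).union
    (Set.finite_singleton (0 : k))).infinite_compl.nonempty
  rw [Set.mem_compl_iff, Set.mem_union, not_or, Set.mem_singleton_iff] at ht
  rw [hN] at hM hn
  have hL := unipotent_smul_diagLattice_mem g' hM t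
  refine ⟨g' • unipotent (e 1) t • diagLattice k e, ?_, ?_⟩
  · by_contra hLU
    refine ht.1 ⟨_, hLU, hL.1.trans hM.1.symm, hn _ hL, ?_⟩
    rintro _ ⟨v, hv, rfl⟩
    rw [glMap_apply, hB, mulVec_mem_glSmul_iff, mulVec_mem_glSmul_iff]
    exact hv
  · refine mem_orbit_of_not_le (hN ▸ hL) ?_
    rw [hN]
    exact unipotent_smul_diagLattice_not_le g' e ht.2

/-! ### Irreducibility -/

lemma exists_integral_matrix {h : GL (Fin 2) k⸨X⸩} (hh : h • standardLattice k = standardLattice k) :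
    ∃ H : Matrix (Fin 2) (Fin 2) k⟦X⟧, h.1 = H.map (algebraMap k⟦X⟧ k⸨X⸩) := by
  have key : ∀ i j, ∃ x : k⟦X⟧, algebraMap k⟦X⟧ k⸨X⸩ x = h.1 i j := by
    intro i j
    have hj : h.1.mulVec (Pi.single j 1) ∈ (h • standardLattice k).toSubmodule :=
      (mulVec_mem_glSmul_iff _ _ _).mpr (Submodule.subset_span ⟨j, rfl⟩)
    rw [hh, Matrix.mulVec_single_one, mem_standardLattice_iff] at hj
    exact (mem_range_algebraMap_iff _).mpr (hj i)
  choose H hH using key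
  exact ⟨Matrix.of H, by ext1 i j; exact (hH i j).symm⟩

lemma exists_gl_of_isUnit_det {H : Matrix (Fin 2) (Fin 2) k⟦X⟧} (hH : IsUnit H.det) :
    ∃ h : GL (Fin 2) k⸨X⸩, h.1 = H.map (algebraMap k⟦X⟧ k⸨X⸩) ∧
      h • standardLattice k = standardLattice k := by
  have hle : ∀ G : GL (Fin 2) k⟦X⟧,
      (Matrix.GeneralLinearGroup.map (algebraMap k⟦X⟧ k⸨X⸩) G • standardLattice k).toSubmodule ≤
        (standardLattice k).toSubmodule := by
    intro G
    rw [glSmul_toSubmodule, standardLattice, Submodule.map_span, Submodule.span_le]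
    rintro _ ⟨_, ⟨j, rfl⟩, rfl⟩
    change _ ∈ (standardLattice k).toSubmodule
    rw [glMap_apply, Matrix.mulVec_single_one, mem_standardLattice_iff]
    exact fun i => (mem_range_algebraMap_iff _).mp ⟨G.1 i j, rfl⟩
  obtain ⟨G, rfl⟩ := (Matrix.isUnit_iff_isUnit_det H).mpr hH
  refine ⟨Matrix.GeneralLinearGroup.map (algebraMap k⟦X⟧ k⸨X⸩) G, rfl,
    GrLattice.ext (le_antisymm (hle G) ?_)⟩
  rw [← glSmul_le_iff (Matrix.GeneralLinearGroup.map (algebraMap k⟦X⟧ k⸨X⸩) G)⁻¹, inv_smul_smul,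
    ← map_inv]
  exact hle G⁻¹

/-- An integral matrix lies in `GL₂(k[[u]])` once its determinant is nonzero modulo `u`. For `1 + t
(h - 1)` that residue is a polynomial in `t` with value `1` at `t = 0`. -/
lemma finite_setOf_not_exists_gl_of_standardLattice {h : GL (Fin 2) k⸨X⸩}
    (hh : h • standardLattice k = standardLattice k) :
    {t : k | ¬ ∃ h' : GL (Fin 2) k⸨X⸩, h' • standardLattice k = standardLattice k ∧
      h'.1 = 1 + (HahnSeries.C t : k⸨X⸩) • (h.1 - 1)}.Finite := by
  obtain ⟨H, hH⟩ := exists_integral_matrix hh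
  -- The determinant as a polynomial, to be restricted to the line through the identity in the
  -- direction of `H - 1` modulo `u`.
  let f : MvPolynomial (Fin 2 × Fin 2) k := MvPolynomial.X (0, 0) * MvPolynomial.X (1, 1) -
    MvPolynomial.X (0, 1) * MvPolynomial.X (1, 0)
  let c (s : Fin 2 × Fin 2) : k := (1 : Matrix (Fin 2) (Fin 2) k) s.1 s.2
  let d (s : Fin 2 × Fin 2) : k := PowerSeries.constantCoeff ((H - 1) s.1 s.2)
  refine (finite_setOf_eval_line_eq_zero f c d (by simp [f, c])).subset fun t ht => ?_
  by_contra hne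
  apply ht
  have hdet : IsUnit (1 + (PowerSeries.C t : k⟦X⟧) • (H - 1)).det := by
    rw [PowerSeries.isUnit_iff_constantCoeff, isUnit_iff_ne_zero]
    convert hne
    rw [Matrix.det_fin_two]
    simp [f, c, d]
  obtain ⟨h', h1, h2⟩ := exists_gl_of_isUnit_det hdet
  refine ⟨h', h2, ?_⟩
  rw [h1, hH]
  ext1 i j
  rcases eq_or_ne i j with rfl | hij
  · simp
  · simp [hij]

lemma finite_setOf_not_exists_gl {N : GrLattice k} {h : GL (Fin 2) k⸨X⸩} (hh : h • N = N) :
    {t : k | ¬ ∃ h' : GL (Fin 2) k⸨X⸩, h' • N = N ∧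
      h'.1 = 1 + (HahnSeries.C t : k⸨X⸩) • (h.1 - 1)}.Finite := by
  obtain ⟨g, rfl⟩ := exists_gl N
  have hh' : (g⁻¹ * h * g) • standardLattice k = standardLattice k := by
    rw [mul_smul, mul_smul, hh, inv_smul_smul]
  refine (finite_setOf_not_exists_gl_of_standardLattice hh').subset fun t ht => ?_
  by_contra hne
  rw [Set.mem_ofPred_eq, not_not] at hne
  apply ht
  obtain ⟨h', h1, h2⟩ := hne
  refine ⟨g * h' * g⁻¹, by rw [mul_smul, mul_smul, inv_smul_smul, h1], ?_⟩
  have hg : g.1 * (g⁻¹).1 = 1 := by rw [← Units.val_mul, mul_inv_cancel, Units.val_one]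
  have hgh : g.1 * ((g⁻¹).1 * h.1 * g.1) * (g⁻¹).1 = h.1 := by
    rw [← Matrix.mul_assoc, ← Matrix.mul_assoc, hg, Matrix.one_mul, Matrix.mul_assoc, hg,
      Matrix.mul_one]
  rw [Units.val_mul, Units.val_mul, h2, Units.val_mul, Units.val_mul, Matrix.mul_add,
    Matrix.add_mul, Matrix.mul_one, hg, Matrix.mul_smul, Matrix.smul_mul, Matrix.mul_sub,
    Matrix.sub_mul, hgh, Matrix.mul_one, hg]

/-- With `M₂ = g M₁`, the family `(1 + t (g - 1)) M₁` passes through `M₁` at `t = 0` and `M₂` at `t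
= 1`. Almost all of its members lie in the orbit, in `U` and in `V` simultaneously. -/
lemma isPreirreducible_orbit [Infinite k] {N M : GrLattice k} {m : ℤ} (hM : M ∈ schubertSet N m) :
    IsPreirreducible (MulAction.orbit (latticeGL N) M) := by
  rintro U V hU hV ⟨M₁, hM₁', hU₁⟩ ⟨M₂, hM₂', hV₂⟩
  obtain ⟨n, hn⟩ := exists_isBounded N m
  have hM₁ : M₁ ∈ schubertSet N m := orbit_subset_schubertSet hM hM₁'
  have hM₂ : M₂ ∈ schubertSet N m := orbit_subset_schubertSet hM hM₂'
  obtain ⟨h₁, hN₁, hh₁⟩ := mem_orbit_latticeGL_iff.mp hM₁'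
  obtain ⟨h₂, hN₂, hh₂⟩ := mem_orbit_latticeGL_iff.mp hM₂'
  obtain ⟨g, hgN, hg⟩ : ∃ g : GL (Fin 2) k⸨X⸩, g • N = N ∧ M₂ = g • M₁ := by
    refine ⟨h₂ * h₁⁻¹, ?_, ?_⟩
    · rw [mul_smul, inv_smul_eq_iff.mpr hN₁.symm, hN₂]
    · rw [mul_smul, hh₁, inv_smul_smul, hh₂]
  -- Seen from `M₂` the parameter is `1 - t`, since `(1 + t (g - 1)) g⁻¹ = 1 + (1 - t) (g⁻¹ - 1)`.
  have hbad₂ := (finite_setOf_line_notMem (hn _ hM₂) hV hV₂ ((g⁻¹).1 - 1)).preimage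
    (sub_right_injective (b := (1 : k))).injOn
  obtain ⟨t, ht⟩ := (((finite_setOf_line_notMem (hn _ hM₁) hU hU₁ (g.1 - 1)).union hbad₂).union
    (finite_setOf_not_exists_gl hgN)).infinite_compl.nonempty
  rw [Set.mem_compl_iff, Set.mem_union, Set.mem_union, not_or, not_or] at ht
  obtain ⟨⟨htU, htV⟩, ht⟩ := ht
  rw [Set.mem_ofPred_eq, not_not] at ht
  obtain ⟨h', hN, hh'⟩ := ht
  have happly : ∀ v, h'.1.mulVec v = v + t • (g.1 - 1).mulVec v := by
    intro v
    rw [hh', Matrix.add_mulVec, Matrix.one_mulVec, Matrix.smul_mulVec, smul_eq_C_smul]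
  have hL := glSmul_mem_schubertSet hN hM₁
  refine ⟨h' • M₁, mem_orbit_latticeGL_iff.mpr ⟨h' * h₁, ?_, ?_⟩, ?_, ?_⟩
  · rw [mul_smul, hN₁, hN]
  · rw [mul_smul, hh₁]
  · by_contra hLU
    refine htU ⟨_, hLU, hL.1.trans hM₁.1.symm, hn _ hL, fun v hv => ?_⟩
    rw [← happly, mulVec_mem_glSmul_iff]
    exact hv
  · by_contra hLV
    refine htV ⟨_, hLV, hL.1.trans hM₂.1.symm, hn _ hL, fun v hv => ?_⟩
    rw [hg, mem_glSmul_iff] at hv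
    have hgg : g.1.mulVec ((g⁻¹).1.mulVec v) = v := by
      rw [Matrix.mulVec_mulVec, ← Units.val_mul, mul_inv_cancel, Units.val_one,
        Matrix.one_mulVec]
    have := (mulVec_mem_glSmul_iff h' _ _).mpr hv
    rw [happly, Matrix.sub_mulVec, hgg, Matrix.one_mulVec] at this
    convert this using 1
    change v + (1 - t) • ((g⁻¹).1 - 1).mulVec v = _
    rw [Matrix.sub_mulVec, Matrix.one_mulVec, sub_smul, one_smul, smul_sub, smul_sub]
    abel

lemma exists_schubertSet_eq_closure_orbit [Infinite k] {N : GrLattice k} {m : ℤ}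
    (h : (schubertSet N m).Nonempty) :
    ∃ M ∈ schubertSet N m, schubertSet N m = closure (MulAction.orbit (latticeGL N) M) := by
  obtain ⟨g, rfl⟩ := exists_gl N
  obtain ⟨M, hM⟩ := h
  have hgen : schubertGenerator g m ∈ schubertSet (g • standardLattice k) m :=
    schubertGenerator_mem (hM.1 ▸ detVal_le_of_le hM.2)
  exact ⟨_, hgen, (schubertSet_subset_closure g m).antisymm
    (closure_minimal (orbit_subset_schubertSet hgen) (isClosed_schubertSet _ m))⟩

lemma isIrreducible_schubertSet [Infinite k] {N : GrLattice k} {m : ℤ}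
    (h : (schubertSet N m).Nonempty) : IsIrreducible (schubertSet N m) := by
  obtain ⟨M, hM, heq⟩ := exists_schubertSet_eq_closure_orbit h
  refine ⟨h, ?_⟩
  rw [heq]
  exact (isPreirreducible_orbit hM).closure

end AffGr

end

/-! ### The main theorem -/

theorem mainTheorem6 (p : ℕ) [Fact p.Prime]
    (k : Type*) [Field k] [Algebra (ZMod p) k] [IsAlgClosure (ZMod p) k]
    (m : ℤ) (x₁ x₂ : AffGr.Building k) (r₁ r₂ : ℚ)
    (X : Set (AffGr.GrLattice k))
    (hX : X = {M : AffGr.GrLattice k |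
      M.det = Submodule.span k⟦X⟧ {((AffGr.u k ^ m : k⸨X⸩ˣ) : k⸨X⸩)} ∧
      M.point.dist x₁ ≤ r₁ ∧
      M.point.dist x₂ ≤ r₂}) :
    AffGr.IsClosedSubvariety X ∧
    (X.Nonempty →
      (∃ N M : AffGr.GrLattice k, X = closure (MulAction.orbit (AffGr.latticeGL N) M)) ∧
      IsConnected X) := by
  have : IsAlgClosed k := IsAlgClosure.isAlgClosed (ZMod p)
  have : Infinite k := IsAlgClosed.instInfinite
  obtain ⟨N, hN⟩ := AffGr.exists_eq_schubertSet m x₁ x₂ r₁ r₂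
  rw [hX, hN]
  refine ⟨AffGr.isClosedSubvariety_schubertSet N m, fun h => ⟨?_, ?_⟩⟩
  · obtain ⟨M, -, hM⟩ := AffGr.exists_schubertSet_eq_closure_orbit h
    exact ⟨N, M, hM⟩
  · exact (AffGr.isIrreducible_schubertSet h).isConnected
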